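/- **Setting.** There are $N\ge 1$ users, $K\ge 1$ arms and $T\ge 1$ rounds, and an anonymity parameter $C\ge 1$. In each round $t$ the learner assigns every user $i$ to an arm $j$, and the user receives a reward drawn (independently over rounds, users and arms) from an unknown distribution $\mathcal D_{i,j}$ with mean $\mu_{i,j}\in[0,1]$ whose centering is $1$-subgaussian. In each round the learner also reports disjoint groups of users, each of size at least $C$ and with all its users assigned to the same arm, and it observes only the total reward of each reported group; its decisions depend only on these past observations. With $r_{i,t}$ the reward of user $i$ in round $t$, the regret is $\mathbf{Reg}=T\sum_i\max_j\mu_{i,j}-\mathbb E\big[\sum_{t=1}^T\sum_i r_{i,t}\big]$. The user-cluster assumption with parameter $U$: one can choose an optimal arm $j^*(i)\in\arg\max_j\mu_{i,j}$ for each user so that $|\{i: j^*(i)=j\}|\ge U$ for every arm $j$. **Decompositions.** An assignment $M:[N]\to[K]$ is informative for $(i,j)$ if $M(i)=j$ and $|M^{-1}(j)|\ge C+1$. A real $D$ and sets $A_1,\dots,A_N\subseteq[K]$ define a $U$-batched graph if $D>0$, all $A_i$ are non-empty, and there is $f:[N]\to[K]$ with $f(i)\in A_i$ for all $i$ and $|f^{-1}(j)|\ge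 U$ for all $j$; its weights are $w_{i,j}=D/|A_i|$ if $j\in A_i$ and $w_{i,j}=0$ otherwise. A $C$-anonymous decomposition of it is a finite sequence of assignments $M_r$ with $w_{i,M_r(i)}\neq0$ for all $r,i$ such that for each $(i,j)$ at least $w_{i,j}$ of them are informative for $(i,j)$. An anonymous decomposition algorithm with approximation ratio $\alpha\ge1$ (and additive constant $c\ge 0$) maps each $U$-batched graph to a $C$-anonymous decomposition of it with at most $\alpha D+cNK$ assignments. **Feedback-eliciting sub-algorithm** on an assignment $M$ ($2C+2$ rounds, in all of which $M$ is played): partition the users of each arm with at least $C+1$ users arbitrarily into ordered groups of size between $C+1$ and $2C+1$. In round $0$ report these groups; in round $k=1,\dots,2C+1$ report each of them without its $k$-th user (the whole group if it has fewer than $k$ users). If $i$ is the $k$-th user of a group $G$, then the estimate $\hat\mu_{i,M(i)}$ is the total of $G$ in round $0$ minus the total of $G\setminus\{i\}$ in round $k$. **Algorithm** (input $N,K,C,U,T$, an anonymous decomposition algorithm with ratio $\alpha$, and an elimination parameter $\gamma$). Let $T'=T/(\alpha(2C+2))$, $B=\max(1,\lceil\log_2\log_2T\rceil)$, $t_0=0$,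 $t_b=T'^{\,1-2^{-b}}$ for $0<b<B$, $t_B=T'$, and $D_b=t_b-t_{b-1}$. Let $A_{i,1}=[K]$ for all $i$. For $b=1,\dots,B$: if $D_b,(A_{i,b})_i$ do not define a $U$-batched graph, abort. Otherwise decompose this graph and run the sub-algorithm on each assignment of the decomposition in turn. For every user $i$ and arm $j\in A_{i,b}$ keep the first $\lceil D_b/|A_{i,b}|\rceil$ estimates $\hat\mu_{i,j}$ of this batch; let $n_{i,j}$ and $\sigma_{i,j}$ be the number and the sum of all estimates kept for $(i,j)$ so far, and $\tau_i=\max_{j\in A_{i,b}}n_{i,j}$. Then $A_{i,b+1}$ arises from $A_{i,b}$ by removing all $j$ with $\max_{j'\in A_{i,b}}\sigma_{i,j'}/n_{i,j'}-\sigma_{i,j}/n_{i,j}\ge\sqrt{\gamma/\tau_i}$. In rounds that are left after the last batch or after aborting, each user plays an arbitrary arm of her last active set $A_{i,b}$ and nothing is observed; if the batches take more than $T$ rounds, the algorithm is cut off after $T$ rounds. **Theorem.** (a) There is a universal constant $g_0>0$ such that for every $g\ge g_0$ there are constants $A>0$ and $p\in\mathbb N$, depending only on $g$, with the following property. For all $N,K,C,T\ge1$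 and all $U$, $\alpha\ge1$, $c\ge0$, every anonymous decomposition algorithm with ratio $\alpha$ and additive constant $c$ such that $cNK\le\sqrt{\alpha KT}$, and all arbitrary choices above, the algorithm with $\gamma=g\,C\log(NKT)$ is a legal learner for the $C$-anonymous bandit problem, and on every instance that satisfies the user-cluster assumption with parameter $U$ its total reward is integrable and $$\mathbf{Reg}\le A\,\big(1+\log(NKCT)\big)^p\,NC\sqrt{\alpha KT}.$$ (b) For all $N,K,C\ge1$ and $U\ge C+1$ there is an anonymous decomposition algorithm with approximation ratio $\alpha=\max\big(1,\lceil K(C+1)/U\rceil\big)$ and additive constant $c=2$. -/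

import Mathlib

open scoped BigOperators
open MeasureTheory ProbabilityTheory

namespace AnonBandit

/-! ### The anonymous bandit problem -/

/-- A table of rewards: `x (t, i, j)` is the reward that user `i` receives in round `t` if she is
assigned to arm `j` in that round. Rounds are numbered from `0`. -/
abbrev RewardTable (N K : ℕ) : Type := ℕ × Fin N × Fin K → ℝ

/-- What the learner does in one round: an assignment of the users to the arms, and the groups of
users whose aggregate rewards are observed (users outside all groups give no feedback). -/
structure RoundAction (N K : ℕ) where
  arm : Fin N → Fin K
  groups : Finset (Finset (Fin N))

/-- Total reward in round `t` of the users in `G` under the assignment `M`. -/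
def groupReward {N K : ℕ} (x : RewardTable N K) (t : ℕ) (M : Fin N → Fin K)
    (G : Finset (Fin N)) : ℝ :=
  ∑ i ∈ G, x (t, i, M i)

/-- The action respects anonymity level `C`: the groups are disjoint, each has at least `C` users,
and all users in a group play the same arm. -/
structure RoundAction.IsAnonymous {N K : ℕ} (C : ℕ) (a : RoundAction N K) : Prop where
  disjoint : ∀ G ∈ a.groups, ∀ H ∈ a.groups, G ≠ H → Disjoint G H
  card_le : ∀ G ∈ a.groups, C ≤ G.card
  same_arm : ∀ G ∈ a.groups, ∀ i ∈ G, ∀ i' ∈ G, a.arm i = a.arm i'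

/-- The behaviour of a (deterministic) learner: its action in round `t` when the table of rewards
is `x`. -/
abbrev Strategy (N K : ℕ) : Type := RewardTable N K → ℕ → RoundAction N K

/-- `S` is a legal learner for the `C`-anonymous bandit problem: all its actions respect anonymity
level `C`, and its action in round `t` is determined by the feedback (the total rewards of the
reported groups) of the rounds before `t`. -/
structure Strategy.IsAnonymous {N K : ℕ} (C : ℕ) (S : Strategy N K) : Prop where
  action : ∀ x t, (S x t).IsAnonymous C
  feedback_only : ∀ x y t,
    (∀ s < t, ∀ G ∈ (S x s).groups,
      groupReward x s (S x s).arm G = groupReward y s (S x s).arm G) →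
    S x t = S y t

/-- The law of the table of rewards: all rewards are independent, and user `i` draws from `ν i j`
at arm `j`. -/
noncomputable def rewardLaw {N K : ℕ} (ν : Fin N → Fin K → Measure ℝ)
    [∀ i j, IsProbabilityMeasure (ν i j)] : Measure (RewardTable N K) :=
  Measure.infinitePi (fun p : ℕ × Fin N × Fin K => ν p.2.1 p.2.2)

/-- The mean reward of user `i` at arm `j`. -/
noncomputable def meanReward {N K : ℕ} (ν : Fin N → Fin K → Measure ℝ) (i : Fin N)
    (j : Fin K) : ℝ :=
  ∫ r, r ∂(ν i j)

/-- The reward distributions are `1`-subgaussian (after centering), with means in `[0, 1]`. -/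
structure IsInstance {N K : ℕ} (ν : Fin N → Fin K → Measure ℝ) : Prop where
  subgaussian : ∀ i j, HasSubgaussianMGF (fun r => r - meanReward ν i j) 1 (ν i j)
  mean_mem : ∀ i j, meanReward ν i j ∈ Set.Icc (0 : ℝ) 1

/-- User-cluster assumption: for a choice `jopt i` of an optimal arm for each user `i`, every arm
is the optimal arm of at least `U` users. -/
def UserCluster {N K : ℕ} (U : ℕ) (μ : Fin N → Fin K → ℝ) : Prop :=
  ∃ jopt : Fin N → Fin K, (∀ i j, μ i j ≤ μ i (jopt i)) ∧
    ∀ j, U ≤ (Finset.univ.filter (fun i => jopt i = j)).card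

/-- Total reward of all users in the first `T` rounds. -/
def totalReward {N K : ℕ} (S : Strategy N K) (T : ℕ) (x : RewardTable N K) : ℝ :=
  ∑ t ∈ Finset.range T, ∑ i, x (t, i, (S x t).arm i)

/-- Expected regret over `T` rounds. -/
noncomputable def regret {N K : ℕ} (ν : Fin N → Fin K → Measure ℝ)
    [∀ i j, IsProbabilityMeasure (ν i j)] (S : Strategy N K) (T : ℕ) : ℝ :=
  T * ∑ i, (⨆ j, meanReward ν i j) - ∫ x, totalReward S T x ∂(rewardLaw ν)

/-! ### Anonymous decompositions -/

/-- The assignment `M` is informative for the pair `(i, j)`: user `i` is assigned to `j`, together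
with at least `C` other users. -/
def Informative {N K : ℕ} (C : ℕ) (M : Fin N → Fin K) (i : Fin N) (j : Fin K) : Prop :=
  M i = j ∧ C + 1 ≤ (Finset.univ.filter (fun i' => M i' = j)).card

/-- A finite sequence `assign 0, …, assign (len - 1)` of assignments (later terms are ignored). -/
structure AssignmentSeq (N K : ℕ) where
  len : ℕ
  assign : ℕ → Fin N → Fin K

open Classical in
/-- `M` is a `C`-anonymous decomposition of the bipartite graph with weights `w`. -/
structure AssignmentSeq.IsDecomposition {N K : ℕ} (C : ℕ) (w : Fin N → Fin K → ℝ)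
    (M : AssignmentSeq N K) : Prop where
  demanded : ∀ r < M.len, ∀ i, w i (M.assign r i) ≠ 0
  informative : ∀ i j,
    w i j ≤ ((Finset.range M.len).filter (fun r => Informative C (M.assign r) i j)).card

/-- The batched graph with total demand `D` and demand sets `A i`. -/
noncomputable def batchedWeight {N K : ℕ} (D : ℝ) (A : Fin N → Finset (Fin K)) (i : Fin N)
    (j : Fin K) : ℝ :=
  if j ∈ A i then D / (A i).card else 0

/-- `D` and `A` define a `U`-batched graph: `D` is positive, the demand sets are non-empty, and the
users can be assigned to arms of their demand sets so that each arm gets at least `U` users. -/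
structure IsUBatched {N K : ℕ} (U : ℕ) (D : ℝ) (A : Fin N → Finset (Fin K)) : Prop where
  pos : 0 < D
  nonempty : ∀ i, (A i).Nonempty
  assignment : ∃ f : Fin N → Fin K, (∀ i, f i ∈ A i) ∧
    ∀ j, U ≤ (Finset.univ.filter (fun i => f i = j)).card

/-- `dec` is an anonymous decomposition algorithm with approximation ratio `α`: on every
`U`-batched graph it returns a `C`-anonymous decomposition into at most `α D + c N K`
assignments. -/
def IsDecomposer {N K : ℕ} (C U : ℕ) (α c : ℝ)
    (dec : ℝ → (Fin N → Finset (Fin K)) → AssignmentSeq N K) : Prop :=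
  ∀ D A, IsUBatched U D A →
    (dec D A).IsDecomposition C (batchedWeight D A) ∧ ((dec D A).len : ℝ) ≤ α * D + c * N * K

/-! ### The feedback-eliciting sub-algorithm -/

/-- The arbitrary choices of the feedback-eliciting sub-algorithm: for each assignment `π`, the
users of each arm with at least `C + 1` users are partitioned into groups of size at least `C + 1`
and at most `2 C + 1`, and the users in each group are numbered `1, 2, …`.
Here `grp π i` is the group of user `i` and `pos π i` her number in it; these are only used for
users `i` whose arm has at least `C + 1` users. -/
structure Grouping (N K C : ℕ) where
  grp : (Fin N → Fin K) → Fin N → Finset (Fin N)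
  pos : (Fin N → Fin K) → Fin N → ℕ
  mem : ∀ π i, Informative C π i (π i) → i ∈ grp π i
  same_arm : ∀ π i, Informative C π i (π i) → ∀ i' ∈ grp π i, π i' = π i
  same_grp : ∀ π i, Informative C π i (π i) → ∀ i' ∈ grp π i, grp π i' = grp π i
  le_card : ∀ π i, Informative C π i (π i) → C + 1 ≤ (grp π i).card
  card_le : ∀ π i, Informative C π i (π i) → (grp π i).card ≤ 2 * C + 1
  pos_mem : ∀ π i, Informative C π i (π i) → 1 ≤ pos π i ∧ pos π i ≤ (grp π i).card
  pos_inj : ∀ π i, Informative C π i (π i) → Set.InjOn (pos π) (grp π i)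

namespace Grouping

variable {N K C : ℕ} (𝒢 : Grouping N K C)

/-- The group of user `i` without its `k`-th user; it is the whole group if `k = 0` or if `k`
exceeds the size of the group. -/
def without (π : Fin N → Fin K) (k : ℕ) (i : Fin N) : Finset (Fin N) :=
  (𝒢.grp π i).filter (fun i' => 𝒢.pos π i' ≠ k)

open Classical in
/-- The groups reported in the `k`-th round of the sub-algorithm on `π`, `0 ≤ k ≤ 2 C + 1`. -/
noncomputable def reported (π : Fin N → Fin K) (k : ℕ) : Finset (Finset (Fin N)) :=
  (Finset.univ.filter (fun i => Informative C π i (π i))).image (𝒢.without π k)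

/-- The estimate of the mean reward of user `i` at arm `π i` if the sub-algorithm is run on `π` in
the rounds `s, s + 1, …, s + 2 C + 1`. -/
def estimate (x : RewardTable N K) (s : ℕ) (π : Fin N → Fin K) (i : Fin N) : ℝ :=
  groupReward x s π (𝒢.without π 0 i) -
    groupReward x (s + 𝒢.pos π i) π (𝒢.without π (𝒢.pos π i) i)

end Grouping

/-! ### The algorithm -/

/-- The grid of batched successive elimination with horizon `T'` and `B` batches: `t₀ = 0`,
`t_b = T' ^ (1 - 1 / 2 ^ b)` for `0 < b < B`, and `t_B = T'`. -/
noncomputable def gridPoint (T' : ℝ) (B b : ℕ) : ℝ :=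
  if b = 0 then 0 else if b < B then T' ^ (1 - 1 / (2 : ℝ) ^ b) else T'

/-- The input of the algorithm, with its arbitrary choices: the anonymity parameter `C`, the lower
bound `U` of the user-cluster assumption, the number of rounds `T`, the approximation ratio `α` of
the decomposition algorithm `decompose`, the groups of the feedback-eliciting sub-algorithm, and
an arm `filler S` in each non-empty set `S` of arms. -/
structure Input (N K : ℕ) where
  C : ℕ
  U : ℕ
  T : ℕ
  α : ℝ
  decompose : ℝ → (Fin N → Finset (Fin K)) → AssignmentSeq N K
  grouping : Grouping N K C
  filler : Finset (Fin K) → Fin K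
  filler_mem : ∀ S, S.Nonempty → filler S ∈ S

/-- State before a batch: the first round of the batch, the active arms `A_i` of the users, the
numbers `n_ij` of samples and their sums `σ_ij` (kept by the users' copies of batched successive
elimination), and whether the algorithm has aborted. -/
structure State (N K : ℕ) where
  start : ℕ
  active : Fin N → Finset (Fin K)
  count : Fin N → Fin K → ℕ
  sum : Fin N → Fin K → ℝ
  aborted : Prop

namespace Input

variable {N K : ℕ} (I : Input N K)

/-- The horizon `T' = T / (α (2 C + 2))` of the copies of batched successive elimination. -/
noncomputable def horizon : ℝ := I.T / (I.α * (2 * I.C + 2))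

/-- The number `B = log log T` of batches (logarithms to base `2`, rounded up, at least `1`). -/
noncomputable def batches : ℕ := max 1 ⌈Real.logb 2 (Real.logb 2 I.T)⌉₊

/-- The size `D_b` of the batch with index `b`, where `b = 0` is the first batch. -/
noncomputable def batchSize (b : ℕ) : ℝ :=
  gridPoint I.horizon I.batches (b + 1) - gridPoint I.horizon I.batches b

open Classical in
/-- The indices of the assignments in `M` from which user `i`'s copy of batched successive
elimination gets its feedback on arm `j` in a batch with demand `D` and active arms `A`: the first
`⌈D / |A i|⌉` assignments that are informative for `(i, j)` if `j ∈ A i`, and none otherwise. -/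
noncomputable def sampled (M : AssignmentSeq N K) (D : ℝ) (A : Fin N → Finset (Fin K))
    (i : Fin N) (j : Fin K) : Finset ℕ :=
  (Finset.range M.len).filter (fun r => Informative I.C (M.assign r) i j ∧
    ((Finset.range r).filter (fun r' => Informative I.C (M.assign r') i j)).card <
      ⌈batchedWeight D A i j⌉₊)

open Classical in
/-- The elimination step of batched successive elimination with parameter `γ`: the arm `j ∈ A` is
removed if its empirical mean is smaller than the largest empirical mean of the arms in `A` by at
least `√(γ / τ)`, where `τ` is the largest number of samples of an arm in `A`. -/
noncomputable def eliminate (γ : ℝ) (A : Finset (Fin K)) (n : Fin K → ℕ) (σ : Fin K → ℝ) :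
    Finset (Fin K) :=
  A.filter (fun j => ∀ j' ∈ A, σ j' / n j' - σ j / n j < √(γ / (A.sup n : ℕ)))

/-- The decomposition used in the batch with index `b` from state `s`. -/
noncomputable def decomposition (b : ℕ) (s : State N K) : AssignmentSeq N K :=
  I.decompose (I.batchSize b) s.active

/-- The algorithm stops before the batch with index `b`. -/
def stops (b : ℕ) (s : State N K) : Prop :=
  s.aborted ∨ ¬ IsUBatched I.U (I.batchSize b) s.active

/-- The state at the end of the batch with index `b`, from the state `s` at its beginning. The
sub-algorithm is run on the `r`-th assignment of the decomposition in the `2 C + 2` rounds that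
start with round `s.start + (2 C + 2) r`. -/
noncomputable def afterBatch (γ : ℝ) (x : RewardTable N K) (b : ℕ) (s : State N K) : State N K :=
  let M := I.decomposition b s
  let smp := I.sampled M (I.batchSize b) s.active
  let n : Fin N → Fin K → ℕ := fun i j => s.count i j + (smp i j).card
  let σ : Fin N → Fin K → ℝ := fun i j => s.sum i j +
    ∑ r ∈ smp i j, I.grouping.estimate x (s.start + (2 * I.C + 2) * r) (M.assign r) i
  { start := s.start + (2 * I.C + 2) * M.len
    active := fun i => eliminate γ (s.active i) (n i) (σ i)
    count := n
    sum := σ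
    aborted := False }

open Classical in
/-- The state before the batch with index `b`. -/
noncomputable def state (γ : ℝ) (x : RewardTable N K) : ℕ → State N K
  | 0 => ⟨0, fun _ => Finset.univ, fun _ _ => 0, fun _ _ => 0, False⟩
  | b + 1 =>
    let s := state γ x b
    if I.stops b s then { s with aborted := True } else I.afterBatch γ x b s

/-- The number of batches that have ended by round `t`, which is the index of the batch to which
round `t` belongs if it is less than the number of all batches. -/
noncomputable def currentBatch (γ : ℝ) (x : RewardTable N K) (t : ℕ) : ℕ :=
  ((Finset.range I.batches).filter (fun b => (I.state γ x (b + 1)).start ≤ t)).card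

/-- The algorithm with elimination parameter `γ`. In rounds that are left after the last batch, or
after the algorithm has aborted, it assigns each user to an arbitrary one of her last active arms
and observes nothing. If the batches need more than `T` rounds, then the algorithm is cut off by
the end of the game: only its first `T` rounds enter the regret. -/
noncomputable def strategy (γ : ℝ) : Strategy N K := fun x t =>
  let b := I.currentBatch γ x t
  if b < I.batches then
    let s := I.state γ x b
    let M := (I.decomposition b s).assign ((t - s.start) / (2 * I.C + 2))
    { arm := M
      groups := I.grouping.reported M ((t - s.start) % (2 * I.C + 2)) }
  else
    { arm := fun i => I.filler ((I.state γ x (I.batches - 1)).active i)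
      groups := ∅ }

end Input

end AnonBandit

namespace AnonBandit

/-- A finite set with at least `C + 1` elements can be divided into numbered groups of size between
`C + 1` and `2 C + 1`. -/
theorem exists_groups {α : Type*} [DecidableEq α] (C : ℕ) (s : Finset α) (hs : C + 1 ≤ s.card) :
    ∃ (g : α → Finset α) (pos : α → ℕ), ∀ i ∈ s, i ∈ g i ∧ g i ⊆ s ∧ (∀ i' ∈ g i, g i' = g i) ∧
      C + 1 ≤ (g i).card ∧ (g i).card ≤ 2 * C + 1 ∧ (1 ≤ pos i ∧ pos i ≤ (g i).card) ∧
      Set.InjOn pos (g i) := by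
  classical
  obtain ⟨e, he⟩ : ∃ e : α → ℕ, Set.BijOn e s (Finset.range s.card) := by
    refine ⟨fun a => if h : a ∈ s then s.equivFin ⟨a, h⟩ else 0, ?_, ?_, ?_⟩
    · intro a ha
      have ha' : a ∈ s := ha
      simp [ha']
    · intro a ha b hb hab
      have ha' : a ∈ s := ha
      have hb' : b ∈ s := hb
      simp only [ha', hb', dif_pos] at hab
      simpa using s.equivFin.injective (Fin.ext hab)
    · intro n hn
      have hn' : n < s.card := by simpa using hn
      refine ⟨(s.equivFin.symm ⟨n, hn'⟩ : s), (s.equivFin.symm ⟨n, hn'⟩).2, ?_⟩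
      simp
  set m := s.card with hm
  set q := m / (C + 1) with hq
  have hq1 : 1 ≤ q := (Nat.one_le_div_iff (by omega)).2 hs
  have hqm : q * (C + 1) ≤ m := Nat.div_mul_le_self m (C + 1)
  have hqm' : m < q * (C + 1) + (C + 1) := by
    have := Nat.lt_div_mul_add (a := m) (b := C + 1) (by omega)
    simpa [hq] using this
  let idx : α → ℕ := fun a => min (e a / (C + 1)) (q - 1)
  let g : α → Finset α := fun a => s.filter (fun b => idx b = idx a)
  let pos : α → ℕ := fun a => e a - idx a * (C + 1) + 1
  have hidx_le : ∀ a, idx a * (C + 1) ≤ e a := fun a =>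
    (Nat.mul_le_mul_right _ (min_le_left _ _)).trans (Nat.div_mul_le_self _ _)
  have hidx_lt : ∀ a ∈ s, e a ≤ idx a * (C + 1) + 2 * C := by
    intro a ha
    have h1 : e a < m := by simpa using he.mapsTo ha
    rcases le_total (e a / (C + 1)) (q - 1) with h | h
    · have h2 : idx a = e a / (C + 1) := min_eq_left h
      have := Nat.lt_div_mul_add (a := e a) (b := C + 1) (by omega)
      rw [h2]; omega
    · have h2 : idx a = q - 1 := min_eq_right h
      have h3 : (q - 1) * (C + 1) + (C + 1) = q * (C + 1) := by
        rw [← Nat.succ_mul]; congr 1; omega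
      rw [h2]; omega
  have hinj : ∀ i, Set.InjOn pos (g i) := by
    intro i a ha b hb hab
    have ha' := Finset.mem_filter.1 ha
    have hb' := Finset.mem_filter.1 hb
    apply he.injOn ha'.1 hb'.1
    have h1 := hidx_le a
    have h2 := hidx_le b
    simp only [pos] at hab
    rw [ha'.2] at hab h1
    rw [hb'.2] at hab h2
    omega
  have hcard : ∀ i ∈ s, ∀ k, (∀ l < k, l < C + 1 ∨ idx i * (C + 1) + l ≤ e i) →
      k ≤ (g i).card := by
    intro i hi k hk
    have hsub : Finset.image (fun l => idx i * (C + 1) + l) (Finset.range k) ⊆ (g i).image e := by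
      intro n hn
      obtain ⟨l, hl, rfl⟩ := Finset.mem_image.1 hn
      have hei : e i < m := by simpa using he.mapsTo hi
      have hil : idx i ≤ q - 1 := min_le_right _ _
      have h3 : (q - 1) * (C + 1) + (C + 1) = q * (C + 1) := by
        rw [← Nat.succ_mul]; congr 1; omega
      have h4 : idx i * (C + 1) ≤ (q - 1) * (C + 1) := Nat.mul_le_mul_right _ hil
      have hlm : idx i * (C + 1) + l < m := by
        rcases hk l (Finset.mem_range.1 hl) with h | h <;> omega
      obtain ⟨a, ha, hea⟩ := he.surjOn (show idx i * (C + 1) + l ∈ _ by simpa using hlm)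
      refine Finset.mem_image.2 ⟨a, Finset.mem_filter.2 ⟨ha, ?_⟩, hea⟩
      have hge : idx i ≤ e a / (C + 1) := by
        rw [hea, Nat.le_div_iff_mul_le (by omega)]; omega
      rcases hk l (Finset.mem_range.1 hl) with h | h
      · have : e a / (C + 1) = idx i := by
          rw [hea, mul_comm, Nat.mul_add_div (by omega), Nat.div_eq_of_lt h]; omega
        show min (e a / (C + 1)) (q - 1) = idx i
        rw [this]; exact min_eq_left hil
      · have h5 : e a / (C + 1) ≤ e i / (C + 1) := Nat.div_le_div_right (by omega)
        show min (e a / (C + 1)) (q - 1) = idx i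
        have h6 : min (e a / (C + 1)) (q - 1) ≤ idx i := min_le_min_right _ h5
        exact le_antisymm h6 (le_min hge hil)
    have := Finset.card_le_card hsub
    rw [Finset.card_image_of_injective _ (add_right_injective _), Finset.card_range] at this
    exact this.trans Finset.card_image_le
  refine ⟨g, pos, fun i hi => ⟨Finset.mem_filter.2 ⟨hi, rfl⟩, Finset.filter_subset _ _, ?_, ?_, ?_,
    ⟨by simp [pos], ?_⟩, hinj i⟩⟩
  · intro i' hi'
    have := (Finset.mem_filter.1 hi').2
    simp only [g, this]
  · exact hcard i hi _ (fun l hl => Or.inl hl)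
  · have : (g i).card ≤ (Finset.Icc 1 (2 * C + 1)).card := by
      refine Finset.card_le_card_of_injOn pos ?_ (hinj i)
      intro a ha
      have h1 := hidx_lt a (Finset.mem_filter.1 ha).1
      simp only [pos, Finset.coe_Icc, Set.mem_Icc]
      omega
    simpa using this
  · refine hcard i hi _ (fun l hl => Or.inr ?_)
    have := hidx_le i
    simp only [pos] at hl
    omega

instance {N K C : ℕ} : Nonempty (Grouping N K C) := by
  classical
  have key : ∀ (π : Fin N → Fin K) (j : Fin K), ∃ (g : Fin N → Finset (Fin N)) (pos : Fin N → ℕ),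
      ∀ i, π i = j → Informative C π i j → i ∈ g i ∧ (∀ i' ∈ g i, π i' = j) ∧
      (∀ i' ∈ g i, g i' = g i) ∧
      C + 1 ≤ (g i).card ∧ (g i).card ≤ 2 * C + 1 ∧ (1 ≤ pos i ∧ pos i ≤ (g i).card) ∧
      Set.InjOn pos (g i) := by
    intro π j
    by_cases h : C + 1 ≤ (Finset.univ.filter (fun i' => π i' = j)).card
    · obtain ⟨g, pos, hg⟩ := exists_groups C _ h
      refine ⟨g, pos, fun i hi _ => ?_⟩
      obtain ⟨h1, h2, h3⟩ := hg i (by simpa using hi)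
      exact ⟨h1, fun i' hi' => by simpa using h2 hi', h3⟩
    · exact ⟨fun _ => ∅, fun _ => 0, fun i _ hi => absurd hi.2 h⟩
  choose g pos hg using key
  refine ⟨⟨fun π i => g π (π i) i, fun π i => pos π (π i) i, ?_, ?_, ?_, ?_, ?_, ?_, ?_⟩⟩
  · exact fun π i h => (hg π _ i rfl h).1
  · exact fun π i h => (hg π _ i rfl h).2.1
  · intro π i h i' hi'
    have h1 := (hg π _ i rfl h).2.1 i' hi'
    simp only [h1]
    exact (hg π _ i rfl h).2.2.1 i' hi'
  · exact fun π i h => (hg π _ i rfl h).2.2.2.1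
  · exact fun π i h => (hg π _ i rfl h).2.2.2.2.1
  · exact fun π i h => (hg π _ i rfl h).2.2.2.2.2.1
  · intro π i h a ha b hb hab
    have h1 := (hg π _ i rfl h).2.1
    refine (hg π _ i rfl h).2.2.2.2.2.2 ha hb ?_
    have e1 := h1 a ha
    have e2 := h1 b hb
    simpa only [e1, e2] using hab

end AnonBandit

/-!
**The decomposition algorithm.** Let `f` assign at least `U ≥ C + 1` users to every arm and let
`α = max 1 ⌈K (C + 1) / U⌉`. If `α ≥ K`, the arms are served one after the other for `⌈D⌉` rounds
each, during which the home users `f ⁻¹ {j}` of the served arm `j` all play `j`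
(`exists_decomposition_one_by_one`). If `α < K`, all arms are kept informative all the time by a
rota: in every round, `C + 1` home users of each arm are on duty there (`exists_rota`). A user is on
duty in a fraction of at most `(C + 1) / U ≤ α / K` of the `α D + O(N K)` rounds, and the remaining
`α (1 - α / K) D ≥ (1 - 1 / K) D` rounds suffice to play all her other arms `D / |A i|` times each,
as `α (K - α) ≥ K - 1` for `1 ≤ α ≤ K - 1` (`exists_decomposition_rota`).

**The learner.** All decisions in a batch are determined by the state at its start, and this state
is determined by the feedback of the earlier rounds (`state_eq_of_feedback`), so the learner is
legal, and the regret is the expectation of the pseudo-regret `∑ t i, (max_j μ_ij - μ_{i, arm})`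
(`regret_eq_integral_pseudoRegret`).

An estimate is a sum of at most `4 C + 1` independent centered rewards plus the mean, hence
`(4 C + 1)`-subgaussian (`hasSubgaussianMGF_estimate`). The start of a batch is random, but given
the discrete part of the state at this start, which is a function of earlier rounds, the estimates
of the batch come from fresh rewards. So `exp (l (σ - n μ) - n (4 C + 1) l² / 2)` is a
supermartingale over the batches (`lintegral_exp_potential_le_one`), and by a Chernoff bound for
each of the possible values of `n` all empirical means are accurate up to half of the elimination
threshold, outside of an event of probability `O(1 / (N T))` (`measure_badEvent_mul_le`).

Outside of this event optimal arms survive. By the user-cluster assumption the active sets define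
`U`-batched graphs, so the algorithm never aborts, and the arms of user `i` that are active in batch
`b + 1` have gaps `O(√(γ K / t_b))` (`GoodState.succ`). The grid is such that `t_{b+1} / √t_b = √T'`
for its inner points, and up to a factor of `2` also in the last batch
(`demand_mul_gapBound_le`, `gapBound_last_le`). Thus each of the `O(log T)` batches contributes
`O(N C √(α K T))` up to logarithms; the additive term `c N K` of the decompositions is absorbed by
the assumption on `c`. If `T' ≤ 1`, then the trivial bound `N T` is good enough
(`regret_le_of_horizon_le_one`).
-/

namespace AnonBandit

open scoped ENNReal NNReal

/-! ### Decomposing batched graphs -/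

/-- A finite set with at least `C + 1` elements has a rota which puts at least `C + 1` of them on
duty at any time, and under which everybody is on duty equally often (up to rounding). -/
theorem exists_rota {ι : Type*} [DecidableEq ι] (C : ℕ) (s : Finset ι) (hs : C + 1 ≤ s.card) :
    ∃ duty : ℕ → Finset ι, (∀ t, duty t ⊆ s) ∧ (∀ t, C + 1 ≤ (duty t).card) ∧
      ∀ i, ∀ L : ℕ,
        ((Finset.range L).filter (fun t => i ∈ duty t)).card ≤ L * (C + 1) / s.card + 1 := by
  set u := s.card with hu
  have hu0 : 0 < u := by omega
  -- The seats of a round table with `u` seats are taken `C + 1` at a time.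
  let e := s.equivFin
  let seat : ℕ → ι := fun n => (e.symm ⟨n % u, Nat.mod_lt _ hu0⟩ : s)
  have seat_inj : ∀ a b, seat a = seat b → a % u = b % u := by
    intro a b h
    have := e.symm.injective (Subtype.ext h)
    simpa using this
  refine ⟨fun t => (Finset.range (C + 1)).image (fun k => seat (t * (C + 1) + k)), ?_, ?_, ?_⟩
  · intro t i hi
    obtain ⟨k, -, rfl⟩ := Finset.mem_image.1 hi
    exact (e.symm _).2
  · intro t
    rw [Finset.card_image_of_injOn, Finset.card_range]
    intro a ha b hb hab
    have h1 : a < C + 1 := by simpa using ha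
    have h2 : b < C + 1 := by simpa using hb
    have h3 : t * (C + 1) + a ≡ t * (C + 1) + b [MOD u] := seat_inj _ _ hab
    have h4 : a ≡ b [MOD u] := Nat.ModEq.add_left_cancel' _ h3
    exact Nat.ModEq.eq_of_lt_of_lt h4 (by omega) (by omega)
  · intro i L
    have hmem : ∀ t ∈ (Finset.range L).filter
        (fun t => i ∈ (Finset.range (C + 1)).image (fun k => seat (t * (C + 1) + k))),
        ∃ k < C + 1, seat (t * (C + 1) + k) = i := by
      intro t ht
      obtain ⟨k, hk, h⟩ := Finset.mem_image.1 (Finset.mem_filter.1 ht).2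
      exact ⟨k, by simpa using hk, h⟩
    rcases Finset.eq_empty_or_nonempty ((Finset.range L).filter
        (fun t => i ∈ (Finset.range (C + 1)).image (fun k => seat (t * (C + 1) + k)))) with h | h
    · rw [h]; simp
    obtain ⟨t₀, ht₀⟩ := h
    obtain ⟨k₀, -, hk₀⟩ := hmem t₀ ht₀
    set v := t₀ * (C + 1) + k₀ with hv
    have hcount : ((Finset.range (L * (C + 1))).filter (fun n => n ≡ v [MOD u])).card
        ≤ L * (C + 1) / u + 1 := by
      rw [← Nat.count_eq_card_filter_range, Nat.count_modEq_card _ hu0]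
      split_ifs <;> omega
    refine le_trans ?_ hcount
    choose! k hk hki using hmem
    refine Finset.card_le_card_of_injOn (fun t => t * (C + 1) + k t) ?_ ?_
    · intro t ht
      have htL : t < L := by simpa using (Finset.mem_filter.1 ht).1
      refine Finset.mem_filter.2 ⟨Finset.mem_range.2 ?_, seat_inj _ _ ((hki t ht).trans hk₀.symm)⟩
      have := hk t ht
      have h2 : (t + 1) * (C + 1) ≤ L * (C + 1) := Nat.mul_le_mul_right _ htL
      rw [Nat.succ_mul] at h2
      show t * (C + 1) + k t < L * (C + 1)
      omega
    · intro a ha b hb hab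
      have h1 := hk a ha
      have h2 := hk b hb
      have key : ∀ t, k t < C + 1 → (t * (C + 1) + k t) / (C + 1) = t := by
        intro t ht
        rw [mul_comm, Nat.mul_add_div (by omega), Nat.div_eq_of_lt ht]; omega
      have h3 := key a h1
      have h4 := key b h2
      simp only at hab
      rw [hab] at h3
      exact h3.symm.trans h4

/-- Every element of `B` can be scheduled exactly `q` times within the free times `R`, with a
default `h ∉ B` at all other times. -/
theorem exists_schedule_within {κ : Type*} [DecidableEq κ] (q : ℕ) (h : κ) (B : Finset κ) :
    h ∉ B → ∀ R : Finset ℕ, B.card * q ≤ R.card →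
    ∃ m : ℕ → κ, (∀ t, m t ∈ insert h B) ∧ (∀ t, t ∉ R → m t = h) ∧
      ∀ j ∈ B, (R.filter (fun t => m t = j)).card = q := by
  induction B using Finset.induction_on with
  | empty => exact fun _ R _ => ⟨fun _ => h, by simp, by simp, by simp⟩
  | insert b B hb ih =>
    intro hh R hR
    rw [Finset.card_insert_of_notMem hb, Nat.succ_mul] at hR
    obtain ⟨Q, hQR, hQ⟩ := Finset.exists_subset_card_eq (show q ≤ R.card by omega)
    have hcard : (R \ Q).card = R.card - q := by rw [Finset.card_sdiff_of_subset hQR, hQ]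
    have hbh : h ≠ b := fun e => hh (by simp [e])
    obtain ⟨m, hm1, hm2, hm3⟩ := ih (fun e => hh (by simp [e])) (R \ Q) (by omega)
    refine ⟨fun t => if t ∈ Q then b else m t, ?_, ?_, ?_⟩
    · intro t
      by_cases ht : t ∈ Q
      · simp [ht]
      · have := hm1 t
        simp only [Finset.mem_insert] at this ⊢
        simp only [ht, if_false]
        tauto
    · intro t ht
      have : t ∉ Q := fun e => ht (hQR e)
      simp only [this, if_false]
      exact hm2 t (by simp [ht])
    · intro j hj
      rcases Finset.mem_insert.1 hj with rfl | hj
      · rw [← hQ]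
        congr 1
        ext t
        simp only [Finset.mem_filter]
        constructor
        · rintro ⟨-, h2⟩
          by_contra ht
          simp only [ht, if_false] at h2
          have := hm1 t
          rw [h2, Finset.mem_insert] at this
          rcases this with e | e
          · exact hbh e.symm
          · exact hb e
        · intro ht
          simp [ht, hQR ht]
      · rw [← hm3 j hj]
        congr 1
        ext t
        have hjb : b ≠ j := fun e => hb (e ▸ hj)
        by_cases ht : t ∈ Q <;> simp [ht, hjb]

/-- A timetable of `L` slots in which every element of `A` occurs at least `q` times and the slots
in `F` are reserved for `h`. -/
theorem exists_schedule {κ : Type*} [DecidableEq κ] (q L : ℕ) (A : Finset κ) (h : κ) (hA : h ∈ A)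
    (F : Finset ℕ) (hF : (A.card - 1) * q + ((Finset.range L).filter (· ∈ F)).card ≤ L)
    (hL : A.card * q ≤ L) :
    ∃ m : ℕ → κ, (∀ t, m t ∈ A) ∧ (∀ t ∈ F, m t = h) ∧
      ∀ j ∈ A, q ≤ ((Finset.range L).filter (fun t => m t = j)).card := by
  have hc : (A.erase h).card = A.card - 1 := Finset.card_erase_of_mem hA
  have hA1 : 1 ≤ A.card := Finset.card_pos.2 ⟨h, hA⟩
  have hR : ((Finset.range L).filter (· ∉ F)).card =
      L - ((Finset.range L).filter (· ∈ F)).card := by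
    have := Finset.card_filter_add_card_filter_not (s := Finset.range L) (fun t => t ∈ F)
    rw [Finset.card_range] at this
    omega
  obtain ⟨m, hm1, hm2, hm3⟩ := exists_schedule_within q h (A.erase h) (by simp)
    ((Finset.range L).filter (· ∉ F)) (by rw [hc, hR]; omega)
  rw [Finset.insert_erase hA] at hm1
  have hother : ∀ j ∈ A.erase h, ((Finset.range L).filter (fun t => m t = j)).card = q := by
    intro j hj
    rw [← hm3 j hj]
    congr 1
    ext t
    simp only [Finset.mem_filter]
    refine ⟨fun ⟨h1, h2⟩ => ⟨⟨h1, fun h3 => ?_⟩, h2⟩, fun ⟨⟨h1, _⟩, h2⟩ => ⟨h1, h2⟩⟩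
    have := hm2 t (by simp [h3])
    exact (Finset.ne_of_mem_erase hj) (h2.symm.trans this)
  refine ⟨m, hm1, fun t ht => hm2 t (by simp [ht]), fun j hj => ?_⟩
  by_cases hjh : j = h
  · subst hjh
    have hsum := Finset.card_eq_sum_card_fiberwise (s := Finset.range L) (t := A) (f := m)
      (fun t _ => hm1 t)
    rw [← Finset.add_sum_erase _ _ hj, Finset.sum_congr rfl hother, Finset.sum_const, hc,
      smul_eq_mul, Finset.card_range] at hsum
    have : A.card * q = (A.card - 1) * q + q := by
      rw [← Nat.succ_mul]; congr 1; omega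
    omega
  · exact (hother j (Finset.mem_erase.2 ⟨hjh, hj⟩)).ge

theorem batchedWeight_ne_zero {N K : ℕ} {D : ℝ} (hD : 0 < D) {A : Fin N → Finset (Fin K)}
    {i : Fin N} {j : Fin K} : batchedWeight D A i j ≠ 0 ↔ j ∈ A i := by
  unfold batchedWeight
  split_ifs with h
  · have : (0 : ℝ) < (A i).card := by exact_mod_cast Finset.card_pos.2 ⟨j, h⟩
    simp only [h, iff_true]
    positivity
  · simp [h]

/-- If there are `K` rounds for every unit of demand, the arms can be served one after the other:
while `j` is served, everybody who demands `j` plays `j`. -/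
theorem exists_decomposition_one_by_one {N K C U : ℕ} (hU : C + 1 ≤ U) {D : ℝ}
    {A : Fin N → Finset (Fin K)} (h : IsUBatched U D A) :
    ∃ M : AssignmentSeq N K, M.IsDecomposition C (batchedWeight D A) ∧ M.len = K * ⌈D⌉₊ := by
  classical
  obtain ⟨hD, hne, f, hfA, hfU⟩ := h
  have hn : 0 < ⌈D⌉₊ := Nat.ceil_pos.2 hD
  let arm : ℕ → Fin N → Fin K := fun r i =>
    if h : r / ⌈D⌉₊ < K then (if (⟨r / ⌈D⌉₊, h⟩ : Fin K) ∈ A i then ⟨r / ⌈D⌉₊, h⟩ else f i) else f i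
  have harm : ∀ r (j : Fin K), r / ⌈D⌉₊ = j → ∀ i, j ∈ A i → arm r i = j := by
    intro r j hr i hj
    have h1 : r / ⌈D⌉₊ < K := hr ▸ j.2
    have h2 : (⟨r / ⌈D⌉₊, h1⟩ : Fin K) = j := Fin.ext hr
    simp only [arm, h1, dif_pos, h2, hj, if_true]
  refine ⟨⟨K * ⌈D⌉₊, arm⟩, ⟨?_, ?_⟩, rfl⟩
  · intro r _ i
    rw [batchedWeight_ne_zero hD]
    simp only [arm]
    split_ifs with h1 h2
    · exact h2
    · exact hfA i
    · exact hfA i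
  · intro i j
    by_cases hj : j ∈ A i
    · have hsub : (Finset.range ⌈D⌉₊).image (fun k => j * ⌈D⌉₊ + k) ⊆
          (Finset.range (K * ⌈D⌉₊)).filter (fun r => Informative C (arm r) i j) := by
        intro r hr
        obtain ⟨k, hk, rfl⟩ := Finset.mem_image.1 hr
        have hk' : k < ⌈D⌉₊ := by simpa using hk
        have hdiv : (j * ⌈D⌉₊ + k) / ⌈D⌉₊ = (j : ℕ) := by
          rw [mul_comm, Nat.mul_add_div hn, Nat.div_eq_of_lt hk']; omega
        refine Finset.mem_filter.2 ⟨Finset.mem_range.2 ?_, harm _ j hdiv i hj, ?_⟩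
        · rw [← Nat.div_lt_iff_lt_mul hn, hdiv]; exact j.2
        · refine hU.trans ((hfU j).trans (Finset.card_le_card ?_))
          intro i' hi'
          have hi'' : f i' = j := by simpa using hi'
          simpa using harm _ j hdiv i' (hi'' ▸ hfA i')
      have hcard := Finset.card_le_card hsub
      rw [Finset.card_image_of_injective _ (add_right_injective _), Finset.card_range] at hcard
      have h1 : batchedWeight D A i j ≤ D := by
        simp only [batchedWeight, hj, if_true]
        refine div_le_self hD.le ?_
        exact_mod_cast Finset.card_pos.2 ⟨j, hj⟩
      exact h1.trans ((Nat.le_ceil D).trans (by exact_mod_cast hcard))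
    · simp [batchedWeight, hj]

/-- If every user can spare the time to be on duty at her home arm whenever the rota wants it, all
arms can be kept informative all the time. Here `a` stands for the size of a demand set, and the
rota costs a fraction of at most `(C + 1) / U` of the time. -/
theorem exists_decomposition_rota {N K C U : ℕ} (hU : C + 1 ≤ U) {D : ℝ}
    {A : Fin N → Finset (Fin K)} (h : IsUBatched U D A) (L : ℕ)
    (hL : ∀ a : ℕ, 1 ≤ a → a ≤ K → (a - 1) * ⌈D / a⌉₊ + (L * (C + 1) / U + 1) ≤ L ∧
      a * ⌈D / a⌉₊ ≤ L) :
    ∃ M : AssignmentSeq N K, M.IsDecomposition C (batchedWeight D A) ∧ M.len = L := by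
  classical
  obtain ⟨hD, hne, f, hfA, hfU⟩ := h
  choose duty hduty1 hduty2 hduty3 using fun j : Fin K =>
    exists_rota C (Finset.univ.filter (fun i => f i = j)) (hU.trans (hfU j))
  have hsched : ∀ i, ∃ m : ℕ → Fin K, (∀ t, m t ∈ A i) ∧
      (∀ t ∈ (Finset.range L).filter (fun t => i ∈ duty (f i) t), m t = f i) ∧
      ∀ j ∈ A i, ⌈D / (A i).card⌉₊ ≤ ((Finset.range L).filter (fun t => m t = j)).card := by
    intro i
    have hcK : (A i).card ≤ K := by simpa using Finset.card_le_univ (A i)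
    obtain ⟨h1, h2⟩ := hL (A i).card (Finset.card_pos.2 (hne i)) hcK
    refine exists_schedule _ L (A i) (f i) (hfA i) _ (le_trans ?_ h1) h2
    refine Nat.add_le_add_left ?_ _
    have h3 : L * (C + 1) / (Finset.univ.filter (fun i' => f i' = f i)).card + 1 ≤
        L * (C + 1) / U + 1 :=
      Nat.add_le_add_right (Nat.div_le_div_left (hfU (f i)) (by omega)) 1
    refine le_trans (Finset.card_le_card ?_) ((hduty3 (f i) i L).trans h3)
    intro t ht
    simpa using (Finset.mem_filter.1 ht).2
  choose m hm1 hm2 hm3 using hsched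
  refine ⟨⟨L, fun t i => m i t⟩, ⟨?_, ?_⟩, rfl⟩
  · intro r _ i
    rw [batchedWeight_ne_zero hD]
    exact hm1 i r
  · intro i j
    by_cases hj : j ∈ A i
    · simp only [batchedWeight, hj, if_true]
      refine (Nat.le_ceil _).trans ?_
      refine Nat.cast_le.2 ((hm3 i j hj).trans (Finset.card_le_card ?_))
      intro t ht
      obtain ⟨ht1, ht2⟩ := Finset.mem_filter.1 ht
      refine Finset.mem_filter.2 ⟨ht1, ht2, (hduty2 j t).trans (Finset.card_le_card ?_)⟩
      intro i' hi'
      have hfi : f i' = j := by simpa using hduty1 j t hi'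
      simpa [hfi] using hm2 i' t (by simp only [Finset.mem_filter]; exact ⟨ht1, hfi ▸ hi'⟩)
    · simp [batchedWeight, hj]

/-- A `U`-batched graph with `U ≥ C + 1` has an anonymous decomposition of length at most
`α D + 2 N K`. For `α ≥ K` the arms are served one by one; otherwise all arms are kept informative
by a rota, which is possible since `α (K - α) ≥ K - 1`. -/
theorem exists_decomposition {N K C U : ℕ} (hN : 1 ≤ N) (hK : 1 ≤ K) (hU : C + 1 ≤ U) {D : ℝ}
    {A : Fin N → Finset (Fin K)} (h : IsUBatched U D A) (a : ℕ) (ha1 : 1 ≤ a)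
    (ha : (K * (C + 1) : ℝ) / U ≤ a) :
    ∃ M : AssignmentSeq N K, M.IsDecomposition C (batchedWeight D A) ∧
      (M.len : ℝ) ≤ a * D + 2 * N * K := by
  have hD := h.pos
  have hNR : (1 : ℝ) ≤ N := by exact_mod_cast hN
  have hKR : (1 : ℝ) ≤ K := by exact_mod_cast hK
  rcases le_or_gt K a with haK | haK
  · obtain ⟨M, hM, hlen⟩ := exists_decomposition_one_by_one hU h
    refine ⟨M, hM, ?_⟩
    rw [hlen]
    push_cast
    have h1 : (⌈D⌉₊ : ℝ) ≤ D + 1 := (Nat.ceil_lt_add_one hD.le).le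
    have h2 : (K : ℝ) ≤ a := by exact_mod_cast haK
    calc (K : ℝ) * ⌈D⌉₊ ≤ K * (D + 1) := by gcongr
      _ = K * D + K := by ring
      _ ≤ a * D + 2 * N * K := by
        refine add_le_add (by gcongr) ?_
        nlinarith
  · set L := ⌊a * D + 2 * N * K⌋₊ with hLdef
    have hnn : 0 ≤ a * D + 2 * N * K := by positivity
    have hL1 : (L : ℝ) ≤ a * D + 2 * N * K := Nat.floor_le hnn
    have hL2 : a * D + 2 * N * K - 1 < L := by
      have := Nat.lt_floor_add_one (a * D + 2 * N * K); linarith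
    have hNK : (K : ℝ) ≤ N := by
      obtain ⟨f, -, hf⟩ := h.assignment
      have h1 : K * 1 ≤ N := by
        have hsum := Finset.card_eq_sum_card_fiberwise (s := (Finset.univ : Finset (Fin N)))
          (t := Finset.univ) (f := f) (fun _ _ => by simp)
        have h2 : ∑ j : Fin K, 1 ≤
            ∑ j : Fin K, (Finset.univ.filter (fun i => f i = j)).card :=
          Finset.sum_le_sum (fun j _ => by have := hf j; omega)
        simp only [Finset.sum_const, Finset.card_univ, Fintype.card_fin, smul_eq_mul] at h2 hsum
        rw [hsum]; exact h2
      exact_mod_cast (by omega : K ≤ N)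
    have haR : (1 : ℝ) ≤ a := by exact_mod_cast ha1
    have haKR : (a : ℝ) + 1 ≤ K := by exact_mod_cast haK
    have hUR : (0 : ℝ) < U := by exact_mod_cast (by omega : 0 < U)
    have hrota : ((L * (C + 1) / U : ℕ) : ℝ) ≤ L * a / K := by
      refine Nat.cast_div_le.trans ?_
      push_cast
      rw [div_le_div_iff₀ hUR (by linarith)]
      rw [div_le_iff₀ hUR] at ha
      have : (0 : ℝ) ≤ L := by positivity
      nlinarith
    obtain ⟨M, hM, hlen⟩ := exists_decomposition_rota hU h L (by
      intro d hd1 hdK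
      have hd1R : (1 : ℝ) ≤ d := by exact_mod_cast hd1
      have hdKR : (d : ℝ) ≤ K := by exact_mod_cast hdK
      have hq : (⌈D / d⌉₊ : ℝ) ≤ D / d + 1 := (Nat.ceil_lt_add_one (by positivity)).le
      have hdD : d * (D / d) = D := by field_simp
      constructor
      · have key : ((d : ℝ) - 1) * ⌈D / d⌉₊ + (L * a / K + 1) ≤ L := by
          have h1 : ((d : ℝ) - 1) * ⌈D / d⌉₊ ≤ (d - 1) * (D / d + 1) :=
            mul_le_mul_of_nonneg_left hq (by linarith)
          have h2 : D / K ≤ D / d := by gcongr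
          have h3 : (L : ℝ) * a / K = L - L * ((K - a) / K) := by field_simp; ring
          have h4 : (a * D + 2 * N * K - 1) * ((K - a) / K) ≤ L * ((K - a) / K) := by
            refine mul_le_mul_of_nonneg_right hL2.le (div_nonneg (by linarith) (by linarith))
          have h5 : D - D / K ≤ a * D * ((K - a) / K) := by
            have : a * D * ((K - a) / K) - (D - D / K) = D * ((a - 1) * (K - a - 1)) / K := by
              field_simp; ring
            have h6 : 0 ≤ D * (((a : ℝ) - 1) * (K - a - 1)) / K :=
              div_nonneg (mul_nonneg hD.le (mul_nonneg (by linarith) (by linarith))) (by linarith)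
            linarith
          have h7 : (2 * N * K - 1) * (1 / K) ≤ (2 * (N : ℝ) * K - 1) * ((K - a) / K) := by
            have : (0 : ℝ) ≤ 2 * N * K - 1 := by nlinarith
            gcongr
            linarith
          have h8 : (2 * (N : ℝ) * K - 1) * (1 / K) = 2 * N - 1 / K := by field_simp
          have h9 : 1 / (K : ℝ) ≤ 1 := by rw [div_le_one (by linarith)]; exact hKR
          nlinarith
        have hcast : (((d - 1) * ⌈D / d⌉₊ + (L * (C + 1) / U + 1) : ℕ) : ℝ) ≤ L := by
          push_cast [Nat.cast_sub hd1]
          linarith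
        exact_mod_cast hcast
      · have : ((d * ⌈D / d⌉₊ : ℕ) : ℝ) ≤ L := by
          push_cast
          have h1 : (d : ℝ) * ⌈D / d⌉₊ ≤ d * (D / d + 1) := by gcongr
          nlinarith
        exact_mod_cast this)
    exact ⟨M, hM, hlen ▸ hL1⟩

theorem exists_isDecomposer {N K C U : ℕ} (hN : 1 ≤ N) (hK : 1 ≤ K) (hU : C + 1 ≤ U) :
    ∃ dec : ℝ → (Fin N → Finset (Fin K)) → AssignmentSeq N K,
      IsDecomposer C U (max 1 (⌈(K * (C + 1) : ℝ) / U⌉₊ : ℝ)) 2 dec := by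
  classical
  set a : ℕ := max 1 ⌈(K * (C + 1) : ℝ) / U⌉₊ with ha
  have hcast : max 1 (⌈(K * (C + 1) : ℝ) / U⌉₊ : ℝ) = a := by rw [ha]; push_cast; rfl
  have ha2 : (K * (C + 1) : ℝ) / U ≤ a :=
    (Nat.le_ceil _).trans (Nat.cast_le.2 (le_max_right _ _))
  choose M hM using fun (D : ℝ) (A : Fin N → Finset (Fin K)) (h : IsUBatched U D A) =>
    exists_decomposition hN hK hU h a (le_max_left _ _) ha2
  refine ⟨fun D A => if h : IsUBatched U D A then M D A h else ⟨0, fun _ _ => ⟨0, hK⟩⟩, ?_⟩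
  intro D A h
  rw [hcast]
  simpa [h] using hM D A h

/-! ### Timing of the batches and legality of the learner -/

namespace Grouping

variable {N K C : ℕ} (𝒢 : Grouping N K C)

theorem without_zero {π : Fin N → Fin K} {i : Fin N} (h : Informative C π i (π i)) :
    𝒢.without π 0 i = 𝒢.grp π i := by
  refine Finset.filter_true_of_mem fun i' hi' => ?_
  have hi'' : Informative C π i' (π i') := by
    have := 𝒢.same_arm π i h i' hi'
    refine ⟨rfl, ?_⟩
    rw [this]
    exact h.2
  have := (𝒢.pos_mem π i' hi'').1
  omega

/-- The group of `i` without its number `pos i` is the group without `i`. -/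
theorem without_pos {π : Fin N → Fin K} {i : Fin N} (h : Informative C π i (π i)) :
    𝒢.without π (𝒢.pos π i) i = (𝒢.grp π i).erase i := by
  ext i'
  simp only [without, Finset.mem_filter, Finset.mem_erase]
  constructor
  · rintro ⟨h1, h2⟩
    exact ⟨fun e => h2 (by rw [e]), h1⟩
  · rintro ⟨h1, h2⟩
    exact ⟨h2, fun e => h1 (𝒢.pos_inj π i h h2 (𝒢.mem π i h) e)⟩

theorem le_card_without {π : Fin N → Fin K} (k : ℕ) {i : Fin N} (h : Informative C π i (π i)) :
    C ≤ (𝒢.without π k i).card := by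
  have h1 := 𝒢.le_card π i h
  have h2 : ((𝒢.grp π i).filter (fun i' => 𝒢.pos π i' = k)).card ≤ 1 := by
    refine Finset.card_le_one.2 fun a ha b hb => ?_
    rw [Finset.mem_filter] at ha hb
    exact 𝒢.pos_inj π i h ha.1 hb.1 (ha.2.trans hb.2.symm)
  have h3 := Finset.card_filter_add_card_filter_not (s := 𝒢.grp π i) (fun i' => 𝒢.pos π i' = k)
  have h4 : 𝒢.without π k i = (𝒢.grp π i).filter (fun i' => ¬ 𝒢.pos π i' = k) := rfl
  rw [h4]
  omega

theorem mem_reported {π : Fin N → Fin K} {k : ℕ} {G : Finset (Fin N)} :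
    G ∈ 𝒢.reported π k ↔ ∃ i, Informative C π i (π i) ∧ 𝒢.without π k i = G := by
  classical
  simp [reported]

theorem isAnonymous_reported (π : Fin N → Fin K) (k : ℕ) :
    RoundAction.IsAnonymous C ⟨π, 𝒢.reported π k⟩ where
  disjoint := by
    intro G hG H hH hne
    obtain ⟨i, hi, rfl⟩ := 𝒢.mem_reported.1 hG
    obtain ⟨i', hi', rfl⟩ := 𝒢.mem_reported.1 hH
    rw [Finset.disjoint_left]
    intro a ha ha'
    refine hne ?_
    have e1 := 𝒢.same_grp π i hi a (Finset.mem_filter.1 ha).1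
    have e2 := 𝒢.same_grp π i' hi' a (Finset.mem_filter.1 ha').1
    unfold without
    rw [← e1, e2]
  card_le := by
    intro G hG
    obtain ⟨i, hi, rfl⟩ := 𝒢.mem_reported.1 hG
    exact 𝒢.le_card_without k hi
  same_arm := by
    intro G hG a ha b hb
    obtain ⟨i, hi, rfl⟩ := 𝒢.mem_reported.1 hG
    exact (𝒢.same_arm π i hi a (Finset.mem_filter.1 ha).1).trans
      (𝒢.same_arm π i hi b (Finset.mem_filter.1 hb).1).symm

theorem without_mem_reported {π : Fin N → Fin K} (k : ℕ) {i : Fin N}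
    (h : Informative C π i (π i)) : 𝒢.without π k i ∈ 𝒢.reported π k :=
  𝒢.mem_reported.2 ⟨i, h, rfl⟩

end Grouping

namespace Input

variable {N K : ℕ} (I : Input N K)

/-- The numbers `n_ij` at the end of the batch with index `b` that starts in state `s`. -/
noncomputable def nextCount (b : ℕ) (s : State N K) (i : Fin N) (j : Fin K) : ℕ :=
  s.count i j + (I.sampled (I.decomposition b s) (I.batchSize b) s.active i j).card

/-- The sums `σ_ij` at the end of the batch with index `b` that starts in state `s`. -/
noncomputable def nextSum (x : RewardTable N K) (b : ℕ) (s : State N K) (i : Fin N) (j : Fin K) :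
    ℝ :=
  s.sum i j + ∑ r ∈ I.sampled (I.decomposition b s) (I.batchSize b) s.active i j,
    I.grouping.estimate x (s.start + (2 * I.C + 2) * r) ((I.decomposition b s).assign r) i

theorem afterBatch_eq (γ : ℝ) (x : RewardTable N K) (b : ℕ) (s : State N K) :
    I.afterBatch γ x b s =
      { start := s.start + (2 * I.C + 2) * (I.decomposition b s).len
        active := fun i => eliminate γ (s.active i) (I.nextCount b s i) (I.nextSum x b s i)
        count := I.nextCount b s
        sum := I.nextSum x b s
        aborted := False } := rfl

variable {γ : ℝ} {x y : RewardTable N K} {b t : ℕ}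

theorem state_succ_of_stops (h : I.stops b (I.state γ x b)) :
    I.state γ x (b + 1) = { I.state γ x b with aborted := True } := by
  rw [state]; simp only [h, if_true]

theorem state_succ_of_not_stops (h : ¬ I.stops b (I.state γ x b)) :
    I.state γ x (b + 1) = I.afterBatch γ x b (I.state γ x b) := by
  rw [state]; simp only [h, if_false]

open Classical in
/-- The end of a batch is determined by the state at its beginning. -/
theorem start_succ : (I.state γ x (b + 1)).start = (I.state γ x b).start +
    if I.stops b (I.state γ x b) then 0
    else (2 * I.C + 2) * (I.decomposition b (I.state γ x b)).len := by
  split_ifs with h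
  · rw [state_succ_of_stops I h, add_zero]
  · rw [state_succ_of_not_stops I h, afterBatch_eq]

variable (γ x) in
theorem start_mono : Monotone (fun b => (I.state γ x b).start) :=
  monotone_nat_of_le_succ fun b => by rw [start_succ]; omega

theorem lt_currentBatch_iff (hb : b < I.batches) :
    b < I.currentBatch γ x t ↔ (I.state γ x (b + 1)).start ≤ t := by
  unfold currentBatch
  constructor
  · intro h
    by_contra hlt
    refine absurd h (not_lt.2 ?_)
    have : (Finset.range I.batches).filter (fun b => (I.state γ x (b + 1)).start ≤ t) ⊆
        Finset.range b := by
      intro b' hb'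
      rw [Finset.mem_filter] at hb'
      refine Finset.mem_range.2 (lt_of_not_ge fun hle => hlt ?_)
      exact (I.start_mono γ x (Nat.succ_le_succ hle)).trans hb'.2
    simpa using Finset.card_le_card this
  · intro h
    have : Finset.range (b + 1) ⊆
        (Finset.range I.batches).filter (fun b => (I.state γ x (b + 1)).start ≤ t) := by
      intro b' hb'
      have hb'' : b' ≤ b := by simpa [Nat.lt_succ_iff] using hb'
      exact Finset.mem_filter.2 ⟨Finset.mem_range.2 (by omega),
        (I.start_mono γ x (Nat.succ_le_succ hb'')).trans h⟩
    simpa using Finset.card_le_card this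

variable (γ x t) in
theorem currentBatch_le : I.currentBatch γ x t ≤ I.batches :=
  (Finset.card_filter_le _ _).trans (by simp)

variable (γ x t) in
theorem start_currentBatch_le : (I.state γ x (I.currentBatch γ x t)).start ≤ t := by
  rcases h : I.currentBatch γ x t with _ | c
  · simp [state]
  · have := I.currentBatch_le γ x t
    exact (I.lt_currentBatch_iff (by omega)).1 (by omega)

theorem lt_start_currentBatch_succ (h : I.currentBatch γ x t < I.batches) :
    t < (I.state γ x (I.currentBatch γ x t + 1)).start := by
  by_contra hle
  exact lt_irrefl _ ((I.lt_currentBatch_iff h).2 (not_lt.1 hle))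

theorem currentBatch_eq (hb : b < I.batches) (h1 : (I.state γ x b).start ≤ t)
    (h2 : t < (I.state γ x (b + 1)).start) : I.currentBatch γ x t = b := by
  refine le_antisymm (not_lt.1 fun h => ?_) ?_
  · exact absurd ((I.lt_currentBatch_iff hb).1 h) (not_le.2 h2)
  · rcases b with _ | c
    · exact Nat.zero_le _
    · exact (I.lt_currentBatch_iff (by omega)).2 h1

/-- In the rounds of a batch that is not aborted, the strategy runs the sub-algorithm on the
assignments of the decomposition. -/
theorem strategy_of_mem_batch (hb : b < I.batches) (hs : ¬ I.stops b (I.state γ x b)) {r k : ℕ}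
    (hr : r < (I.decomposition b (I.state γ x b)).len) (hk : k < 2 * I.C + 2) :
    I.strategy γ x ((I.state γ x b).start + (2 * I.C + 2) * r + k) =
      ⟨(I.decomposition b (I.state γ x b)).assign r,
        I.grouping.reported ((I.decomposition b (I.state γ x b)).assign r) k⟩ := by
  have hcur : I.currentBatch γ x ((I.state γ x b).start + (2 * I.C + 2) * r + k) = b := by
    refine I.currentBatch_eq hb (by omega) ?_
    rw [start_succ, if_neg hs]
    have : (2 * I.C + 2) * (r + 1) ≤ (2 * I.C + 2) * (I.decomposition b (I.state γ x b)).len :=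
      Nat.mul_le_mul_left _ hr
    rw [Nat.mul_succ] at this
    omega
  have hsub : (I.state γ x b).start + (2 * I.C + 2) * r + k - (I.state γ x b).start =
      (2 * I.C + 2) * r + k := by omega
  have hdiv : ((2 * I.C + 2) * r + k) / (2 * I.C + 2) = r := by
    rw [Nat.mul_add_div (by omega), Nat.div_eq_of_lt hk]; omega
  have hmod : ((2 * I.C + 2) * r + k) % (2 * I.C + 2) = k := by
    rw [Nat.mul_add_mod, Nat.mod_eq_of_lt hk]
  unfold strategy
  simp only [hcur, hb, if_true, hsub, hdiv, hmod]

theorem mem_sampled {M : AssignmentSeq N K} {D : ℝ} {A : Fin N → Finset (Fin K)} {i : Fin N}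
    {j : Fin K} {r : ℕ} (h : r ∈ I.sampled M D A i j) :
    r < M.len ∧ M.assign r i = j ∧ Informative I.C (M.assign r) i (M.assign r i) := by
  classical
  obtain ⟨h1, h2, -⟩ := Finset.mem_filter.1 h
  exact ⟨Finset.mem_range.1 h1, h2.1, by rw [h2.1]; exact h2⟩

/-- A state that is reached by round `t` is determined by the feedback of the rounds before `t`. -/
theorem state_eq_of_feedback
    (h : ∀ s < t, ∀ G ∈ (I.strategy γ x s).groups,
      groupReward x s (I.strategy γ x s).arm G = groupReward y s (I.strategy γ x s).arm G)
    (hb : b ≤ I.batches) (hs : (I.state γ x b).start ≤ t) :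
    I.state γ x b = I.state γ y b := by
  induction b with
  | zero => rfl
  | succ b ih =>
    have ih := ih (by omega) ((I.start_mono γ x (Nat.le_succ b)).trans hs)
    by_cases hst : I.stops b (I.state γ x b)
    · rw [state_succ_of_stops I hst, state_succ_of_stops I (ih ▸ hst), ih]
    · rw [state_succ_of_not_stops I hst, state_succ_of_not_stops I (ih ▸ hst), ← ih]
      rw [start_succ, if_neg hst] at hs
      have hsum : I.nextSum x b (I.state γ x b) = I.nextSum y b (I.state γ x b) := by
        funext i j
        refine congrArg _ (Finset.sum_congr rfl fun r hr => ?_)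
        obtain ⟨hr1, -, hr2⟩ := I.mem_sampled hr
        have hlen : (2 * I.C + 2) * (r + 1) ≤
            (2 * I.C + 2) * (I.decomposition b (I.state γ x b)).len := Nat.mul_le_mul_left _ hr1
        rw [Nat.mul_succ] at hlen
        have hround : ∀ k < 2 * I.C + 2,
            groupReward x ((I.state γ x b).start + (2 * I.C + 2) * r + k)
              ((I.decomposition b (I.state γ x b)).assign r)
              (I.grouping.without ((I.decomposition b (I.state γ x b)).assign r) k i) =
            groupReward y ((I.state γ x b).start + (2 * I.C + 2) * r + k)
              ((I.decomposition b (I.state γ x b)).assign r)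
              (I.grouping.without ((I.decomposition b (I.state γ x b)).assign r) k i) := by
          intro k hk
          have := h ((I.state γ x b).start + (2 * I.C + 2) * r + k) (by omega)
          rw [I.strategy_of_mem_batch (by omega) hst hr1 hk] at this
          exact this _ (I.grouping.without_mem_reported k hr2)
        have hpos := (I.grouping.pos_mem _ i hr2).2
        have hcard := I.grouping.card_le _ i hr2
        exact congrArg₂ _ (hround 0 (by omega)) (hround _ (by omega))
      rw [afterBatch_eq, afterBatch_eq, hsum]

theorem strategy_eq_of_feedback
    (h : ∀ s < t, ∀ G ∈ (I.strategy γ x s).groups,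
      groupReward x s (I.strategy γ x s).arm G = groupReward y s (I.strategy γ x s).arm G) :
    I.strategy γ x t = I.strategy γ y t := by
  have hle := I.currentBatch_le γ x t
  have hst := I.start_currentBatch_le γ x t
  have heq := I.state_eq_of_feedback h hle hst
  rcases lt_or_ge (I.currentBatch γ x t) I.batches with hlt | hge
  · have hcur : I.currentBatch γ y t = I.currentBatch γ x t := by
      refine I.currentBatch_eq hlt (heq ▸ hst) ?_
      have := I.lt_start_currentBatch_succ hlt
      rwa [start_succ, heq, ← start_succ] at this
    unfold strategy
    simp only [hcur, heq, hlt, if_true]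
  · have hx : I.currentBatch γ x t = I.batches := le_antisymm hle hge
    have hB : 1 ≤ I.batches := le_max_left _ _
    rw [hx] at hst heq
    have hcur : I.currentBatch γ y t = I.batches := by
      refine le_antisymm (I.currentBatch_le γ y t) ?_
      have h1 : I.batches - 1 < I.currentBatch γ y t := by
        refine (I.lt_currentBatch_iff (by omega)).2 ?_
        rw [Nat.sub_add_cancel hB, ← heq]
        exact hst
      omega
    have heq' : I.state γ x (I.batches - 1) = I.state γ y (I.batches - 1) :=
      I.state_eq_of_feedback h (by omega) ((I.start_mono γ x (Nat.sub_le _ _)).trans hst)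
    unfold strategy
    simp only [hcur, hx, lt_irrefl, if_false, heq']

variable (γ) in
theorem isAnonymous_strategy : (I.strategy γ).IsAnonymous I.C where
  action := by
    intro x t
    unfold strategy
    simp only
    split_ifs
    · exact I.grouping.isAnonymous_reported _ _
    · exact ⟨by simp, by simp, by simp⟩
  feedback_only := fun _ _ _ h => I.strategy_eq_of_feedback h

theorem feedback_eq_of_agree (h : ∀ p : ℕ × Fin N × Fin K, p.1 < t → x p = y p) :
    ∀ s < t, ∀ G ∈ (I.strategy γ x s).groups,
      groupReward x s (I.strategy γ x s).arm G = groupReward y s (I.strategy γ x s).arm G :=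
  fun s hs _ _ => Finset.sum_congr rfl fun i _ => h (s, i, _) hs

end Input

/-! ### Measurability of the algorithm -/

/-- Sets of arms carry the discrete σ-algebra. -/
instance {K : ℕ} : MeasurableSpace (Finset (Fin K)) := ⊤

instance {K : ℕ} : DiscreteMeasurableSpace (Finset (Fin K)) := ⟨fun _ => trivial⟩

/-- A function that factors through a measurable map into a countable discrete space is
measurable. -/
theorem measurable_of_factors {Ω ι β : Type*} [MeasurableSpace Ω] [MeasurableSpace ι]
    [DiscreteMeasurableSpace ι] [MeasurableSpace β] {d : Ω → ι} (hd : Measurable d) {f : Ω → β}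
    (hf : ∀ x y, d x = d y → f x = f y) : Measurable f := by
  intro s _
  have : f ⁻¹' s = d ⁻¹' (d '' (f ⁻¹' s)) := by
    refine Set.Subset.antisymm (Set.subset_preimage_image _ _) ?_
    rintro x ⟨y, hy, hxy⟩
    rw [Set.mem_preimage, ← hf y x hxy]
    exact hy
  rw [this]
  exact hd (MeasurableSet.of_discrete)

/-- A function that is measurable for each value of a countable discrete parameter stays measurable
when the parameter is itself a measurable function. -/
theorem measurable_diagonal {Ω ι β : Type*} [MeasurableSpace Ω] [MeasurableSpace ι]
    [DiscreteMeasurableSpace ι] [Countable ι] [MeasurableSpace β] {d : Ω → ι} (hd : Measurable d)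
    {F : ι → Ω → β} (hF : ∀ c, Measurable (F c)) : Measurable (fun x => F (d x) x) :=
  (measurable_from_prod_countable_right (f := fun p : ι × Ω => F p.1 p.2) hF).comp
    (hd.prodMk measurable_id)

variable {N K : ℕ}

/-- The part of a state that has only countably many values: everything except the sums. -/
abbrev DiscreteState (N K : ℕ) : Type :=
  ℕ × (Fin N → Finset (Fin K)) × (Fin N → Fin K → ℕ) × Prop

/-- Everything in a state except the sums. -/
def State.discrete (s : State N K) : DiscreteState N K := (s.start, s.active, s.count, s.aborted)

/-- A state with given discrete part (and arbitrary sums). -/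
noncomputable def DiscreteState.toState (c : DiscreteState N K) : State N K :=
  ⟨c.1, c.2.1, c.2.2.1, fun _ _ => 0, c.2.2.2⟩

theorem measurable_estimate {C : ℕ} (𝒢 : Grouping N K C) (s : ℕ) (π : Fin N → Fin K) (i : Fin N) :
    Measurable (fun x => 𝒢.estimate x s π i) := by
  unfold Grouping.estimate groupReward
  fun_prop

open Input in
theorem measurable_eliminate (γ : ℝ) (A : Finset (Fin K)) (n : Fin K → ℕ) :
    Measurable (eliminate γ A n) := by
  have hmem : ∀ j, MeasurableSet {σ : Fin K → ℝ | j ∈ eliminate γ A n σ} := by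
    intro j
    have : {σ : Fin K → ℝ | j ∈ eliminate γ A n σ} = {σ | j ∈ A} ∩
        ⋂ j' ∈ A, {σ | σ j' / n j' - σ j / n j < √(γ / (A.sup n : ℕ))} := by
      ext σ
      simp [eliminate]
    rw [this]
    refine (MeasurableSet.const _).inter (A.measurableSet_biInter fun j' _ => ?_)
    exact measurableSet_lt (by fun_prop) measurable_const
  refine measurable_to_countable' fun S => ?_
  have : eliminate γ A n ⁻¹' {S} =
      ⋂ j, {σ : Fin K → ℝ | j ∈ eliminate γ A n σ ↔ j ∈ S} := by
    ext σ
    simp [Finset.ext_iff]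
  rw [this]
  refine MeasurableSet.iInter fun j => ?_
  by_cases hj : j ∈ S
  · simpa [hj] using hmem j
  · simp only [hj, iff_false]
    exact (hmem j).compl

namespace Input

variable (I : Input N K) (γ : ℝ)

/-- The sum of the estimates that are kept for `(i, j)` in the batch with index `b`. -/
noncomputable def batchSum (b : ℕ) (s : State N K) (i : Fin N) (j : Fin K) (x : RewardTable N K) :
    ℝ :=
  ∑ r ∈ I.sampled (I.decomposition b s) (I.batchSize b) s.active i j,
    I.grouping.estimate x (s.start + (2 * I.C + 2) * r) ((I.decomposition b s).assign r) i

theorem nextSum_eq (x : RewardTable N K) (b : ℕ) (s : State N K) (i : Fin N) (j : Fin K) :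
    I.nextSum x b s i j = s.sum i j + I.batchSum b s.discrete.toState i j x := rfl

theorem measurable_batchSum (b : ℕ) (s : State N K) (i : Fin N) (j : Fin K) :
    Measurable (I.batchSum b s i j) :=
  Finset.measurable_fun_sum _ fun _ _ => measurable_estimate _ _ _ _

theorem stops_iff (b : ℕ) (s : State N K) : I.stops b s ↔ I.stops b s.discrete.toState := Iff.rfl

theorem measurable_state (b : ℕ) :
    Measurable (fun x => (I.state γ x b).discrete) ∧
      ∀ i j, Measurable (fun x => (I.state γ x b).sum i j) := by
  classical
  induction b with
  | zero =>
    simp only [state]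
    exact ⟨measurable_const, fun i j => measurable_const⟩
  | succ b ih =>
    obtain ⟨hd, hσ⟩ := ih
    have hmeas : MeasurableSet {x | I.stops b (I.state γ x b)} := by
      have : {x | I.stops b (I.state γ x b)} = (fun x => (I.state γ x b).discrete) ⁻¹'
          {c | I.stops b c.toState} := rfl
      rw [this]
      exact hd (MeasurableSet.of_discrete)
    have hnext : ∀ i j, Measurable (fun x => I.nextSum x b (I.state γ x b) i j) := by
      intro i j
      simp only [nextSum_eq]
      exact (hσ i j).add (measurable_diagonal hd (F := fun c x => I.batchSum b c.toState i j x)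
        fun c => I.measurable_batchSum b _ i j)
    have hactive : Measurable (fun x => fun i => eliminate γ ((I.state γ x b).active i)
        (I.nextCount b (I.state γ x b) i) (I.nextSum x b (I.state γ x b) i)) := by
      refine measurable_pi_iff.2 fun i => ?_
      have h1 : Measurable (fun x => (fun j => I.nextSum x b (I.state γ x b) i j)) :=
        measurable_pi_iff.2 fun j => hnext i j
      exact measurable_diagonal hd (F := fun c x => eliminate γ (c.toState.active i)
        (I.nextCount b c.toState i) (fun j => I.nextSum x b (I.state γ x b) i j))
        fun c => (measurable_eliminate _ _ _).comp h1
    constructor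
    · have h : (fun x => (I.state γ x (b + 1)).discrete) = fun x =>
          if I.stops b (I.state γ x b) then
            ((I.state γ x b).start, (I.state γ x b).active, (I.state γ x b).count, True)
          else (I.afterBatch γ x b (I.state γ x b)).discrete := by
        funext x
        split_ifs with hx
        · rw [state_succ_of_stops I hx]; rfl
        · rw [state_succ_of_not_stops I hx]
      rw [h]
      refine Measurable.ite hmeas ?_ ?_
      · exact measurable_of_factors hd (f := fun x =>
          ((I.state γ x b).start, (I.state γ x b).active, (I.state γ x b).count, True))
          fun x y hxy => by
            simp only [State.discrete, Prod.mk.injEq] at hxy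
            simp [hxy]
      · refine Measurable.prodMk ?_ (hactive.prodMk (Measurable.prodMk ?_ measurable_const))
        · exact (Measurable.of_discrete (f := fun c : DiscreteState N K =>
            (c.toState.start + (2 * I.C + 2) * (I.decomposition b c.toState).len : ℕ))).comp hd
        · exact (Measurable.of_discrete (f := fun c : DiscreteState N K =>
            I.nextCount b c.toState)).comp hd
    · intro i j
      have h : (fun x => (I.state γ x (b + 1)).sum i j) = fun x =>
          if I.stops b (I.state γ x b) then (I.state γ x b).sum i j
          else I.nextSum x b (I.state γ x b) i j := by
        funext x
        split_ifs with hx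
        · rw [state_succ_of_stops I hx]
        · rw [state_succ_of_not_stops I hx]; rfl
      rw [h]
      exact Measurable.ite hmeas (hσ i j) (hnext i j)

theorem measurable_count (b : ℕ) (i : Fin N) (j : Fin K) :
    Measurable (fun x => (I.state γ x b).count i j) :=
  (Measurable.of_discrete (f := fun c : DiscreteState N K => c.toState.count i j)).comp
    (I.measurable_state γ b).1

/-- The strategy is determined by the discrete parts of the states. -/
theorem strategy_eq_of_discrete {x y : RewardTable N K} (t : ℕ)
    (h : ∀ b ≤ I.batches, (I.state γ x b).discrete = (I.state γ y b).discrete) :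
    I.strategy γ x t = I.strategy γ y t := by
  have hstart : ∀ b ≤ I.batches, (I.state γ x b).start = (I.state γ y b).start :=
    fun b hb => congrArg (fun c => c.1) (h b hb)
  have hactive : ∀ b ≤ I.batches, (I.state γ x b).active = (I.state γ y b).active :=
    fun b hb => congrArg (fun c => c.2.1) (h b hb)
  have hcur : I.currentBatch γ x t = I.currentBatch γ y t := by
    unfold currentBatch
    congr 1
    refine Finset.filter_congr fun b hb => ?_
    rw [hstart (b + 1) (by simpa using hb)]
  unfold strategy decomposition
  simp only [hcur, hstart _ (I.currentBatch_le γ y t), hactive _ (I.currentBatch_le γ y t),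
    hactive _ (Nat.sub_le _ _)]

theorem measurable_arm (t : ℕ) (i : Fin N) :
    Measurable (fun x => (I.strategy γ x t).arm i) := by
  refine measurable_of_factors (d := fun x => fun b : Fin (I.batches + 1) =>
    (I.state γ x b).discrete) (measurable_pi_iff.2 fun b => (I.measurable_state γ b).1) ?_
  intro x y hxy
  rw [I.strategy_eq_of_discrete γ t fun b hb => congrFun hxy ⟨b, Nat.lt_succ_of_le hb⟩]

end Input

/-! ### Independence of the rewards of different rounds -/

/-- `f` depends only on the rewards of the rounds in `S`. -/
abbrev DependsOnRounds {β : Type*} (f : RewardTable N K → β) (S : Set ℕ) : Prop :=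
  DependsOn f {p : ℕ × Fin N × Fin K | p.1 ∈ S}

theorem DependsOnRounds.comp_left {β δ : Type*} {f : RewardTable N K → β} {S : Set ℕ}
    (hf : DependsOnRounds f S) (φ : β → δ) : DependsOnRounds (fun x => φ (f x)) S :=
  fun _ _ h => congrArg φ (hf h)

theorem DependsOnRounds.mono {β : Type*} {f : RewardTable N K → β} {S S' : Set ℕ}
    (hf : DependsOnRounds f S) (h : S ⊆ S') : DependsOnRounds f S' :=
  fun _ _ hxy => hf fun p hp => hxy p (h hp)

theorem dependsOnRounds_finset_sum {ι : Type*} (s : Finset ι) {f : ι → RewardTable N K → ℝ}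
    {S : Set ℕ} (h : ∀ a ∈ s, DependsOnRounds (f a) S) :
    DependsOnRounds (fun x => ∑ a ∈ s, f a x) S :=
  fun _ _ hxy => Finset.sum_congr rfl fun a ha => h a ha hxy

section Law

variable (ν : Fin N → Fin K → Measure ℝ) [∀ i j, IsProbabilityMeasure (ν i j)]

instance : IsProbabilityMeasure (rewardLaw ν) := by
  unfold rewardLaw; infer_instance

theorem iIndepFun_reward : iIndepFun (fun p (x : RewardTable N K) => x p) (rewardLaw ν) :=
  iIndepFun_infinitePi (P := fun p : ℕ × Fin N × Fin K => ν p.2.1 p.2.2) (X := fun _ r => r)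
    fun _ => measurable_id

theorem map_eval_rewardLaw (p : ℕ × Fin N × Fin K) :
    (rewardLaw ν).map (fun x => x p) = ν p.2.1 p.2.2 :=
  Measure.infinitePi_map_eval (fun p : ℕ × Fin N × Fin K => ν p.2.1 p.2.2) p

/-- Functions of the rewards of disjoint finite sets of rounds are independent. -/
theorem indepFun_of_disjoint_rounds {β δ : Type*} [MeasurableSpace β] [MeasurableSpace δ]
    {S T : Finset ℕ} (hST : Disjoint S T) {f : RewardTable N K → β} {g : RewardTable N K → δ}
    (hf : Measurable f) (hg : Measurable g) (hfS : DependsOnRounds f S)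
    (hgT : DependsOnRounds g T) : IndepFun f g (rewardLaw ν) := by
  classical
  let P : Finset ℕ → Finset (ℕ × Fin N × Fin K) := fun S => S ×ˢ Finset.univ
  -- A function of the rounds in `S` factors through the restriction to these rounds.
  let ext : ∀ S : Finset ℕ, (P S → ℝ) → RewardTable N K :=
    fun S y p => if h : p ∈ P S then y ⟨p, h⟩ else 0
  have hext : ∀ S, Measurable (ext S) := by
    intro S
    refine measurable_pi_iff.2 fun p => ?_
    by_cases h : p ∈ P S
    · simp only [ext, h, dif_pos]; exact measurable_pi_apply _
    · simp only [ext, h, dif_neg, not_false_iff]; exact measurable_const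
  have hfac : ∀ (S : Finset ℕ) (x : RewardTable N K) (p : ℕ × Fin N × Fin K),
      p ∈ {p : ℕ × Fin N × Fin K | p.1 ∈ (S : Set ℕ)} →
      x p = ext S (fun q : P S => x q) p := by
    intro S x p hp
    have h : p ∈ P S := Finset.mem_product.2 ⟨hp, Finset.mem_univ _⟩
    simp only [ext, h, dif_pos]
  have hdisj : Disjoint (P S) (P T) := Finset.disjoint_product.2 (Or.inl hST)
  have hind := (iIndepFun_reward ν).indepFun_finset (P S) (P T) hdisj
    (fun p => measurable_pi_apply p)
  have h := hind.comp (hf.comp (hext S)) (hg.comp (hext T))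
  have e1 : f = (f ∘ ext S) ∘ fun x (q : P S) => x q := by
    funext x; exact hfS (hfac S x)
  have e2 : g = (g ∘ ext T) ∘ fun x (q : P T) => x q := by
    funext x; exact hgT (hfac T x)
  rw [e1, e2]
  exact h

variable {ν}

theorem hasSubgaussianMGF_reward (hν : IsInstance ν) (p : ℕ × Fin N × Fin K) :
    HasSubgaussianMGF (fun x : RewardTable N K => x p - meanReward ν p.2.1 p.2.2) 1
      (rewardLaw ν) := by
  have h := hν.subgaussian p.2.1 p.2.2
  rw [← map_eval_rewardLaw ν p] at h
  exact HasSubgaussianMGF.of_map (Y := fun x : RewardTable N K => x p)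
    (measurable_pi_apply p).aemeasurable h

theorem integrable_reward (hν : IsInstance ν) (p : ℕ × Fin N × Fin K) :
    Integrable (fun x : RewardTable N K => x p) (rewardLaw ν) := by
  refine ((hasSubgaussianMGF_reward hν p).integrable.add
    (integrable_const (meanReward ν p.2.1 p.2.2))).congr (Filter.Eventually.of_forall fun x => ?_)
  simp

variable (ν) in
theorem integral_reward (p : ℕ × Fin N × Fin K) :
    ∫ x : RewardTable N K, x p ∂(rewardLaw ν) = meanReward ν p.2.1 p.2.2 := by
  rw [meanReward, ← map_eval_rewardLaw ν p]
  have h : AEMeasurable (fun x : RewardTable N K => x p) (rewardLaw ν) :=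
    (measurable_pi_apply p).aemeasurable
  have hid : Measurable (fun r : ℝ => r) := measurable_id
  exact (integral_map h hid.aestronglyMeasurable).symm

/-! ### Regret of a predictable strategy -/

theorem integrable_reward_arm (hν : IsInstance ν) {a : RewardTable N K → Fin K}
    (ha : Measurable a) (t : ℕ) (i : Fin N) :
    Integrable (fun x => x (t, i, a x)) (rewardLaw ν) := by
  have h : (fun x : RewardTable N K => x (t, i, a x)) =
      fun x => ∑ j, {x | a x = j}.indicator (fun x => x (t, i, j)) x := by
    funext x
    rw [Finset.sum_eq_single (a x)]
    · simp
    · intro j _ hj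
      simp [Ne.symm hj]
    · simp
  rw [h]
  exact integrable_finsetSum _ fun j _ =>
    (integrable_reward hν _).indicator (ha (measurableSet_singleton j))

/-- If the arm of a user in round `t` depends only on earlier rounds, then her expected reward is
the expected mean reward of her arm. -/
theorem integral_reward_arm (hν : IsInstance ν) {a : RewardTable N K → Fin K}
    (ha : Measurable a) (t : ℕ) (i : Fin N) (hat : DependsOnRounds a (Finset.range t)) :
    ∫ x, x (t, i, a x) ∂(rewardLaw ν) = ∫ x, meanReward ν i (a x) ∂(rewardLaw ν) := by
  have hset : ∀ j, MeasurableSet {x | a x = j} := fun j => ha (measurableSet_singleton j)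
  have h : ∀ f : Fin K → RewardTable N K → ℝ, (fun x => f (a x) x) =
      fun x => ∑ j, {x | a x = j}.indicator (fun _ => (1 : ℝ)) x * f j x := by
    intro f
    funext x
    rw [Finset.sum_eq_single (a x)]
    · simp
    · intro j _ hj
      simp [Ne.symm hj]
    · simp
  have hone : ∀ j, Measurable ({x | a x = j}.indicator (fun _ => (1 : ℝ))) :=
    fun j => measurable_const.indicator (hset j)
  rw [h (fun j x => x (t, i, j)), h (fun j _ => meanReward ν i j)]
  have hint : ∀ j (f : RewardTable N K → ℝ), Integrable f (rewardLaw ν) →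
      Integrable (fun x => {x | a x = j}.indicator (fun _ => (1 : ℝ)) x * f x) (rewardLaw ν) := by
    intro j f hf
    have := hf.indicator (hset j)
    refine this.congr (Filter.Eventually.of_forall fun x => ?_)
    by_cases hx : a x = j <;> simp [hx]
  rw [integral_finsetSum _ fun j _ => hint j _ (integrable_reward hν _),
    integral_finsetSum _ fun j _ => hint j _ (integrable_const _)]
  refine Finset.sum_congr rfl fun j _ => ?_
  have hindep : IndepFun ({x | a x = j}.indicator (fun _ => (1 : ℝ)))
      (fun x : RewardTable N K => x (t, i, j)) (rewardLaw ν) := by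
    refine indepFun_of_disjoint_rounds ν (S := Finset.range t) (T := {t}) (by simp)
      (hone j) (measurable_pi_apply _) ?_ ?_
    · intro x y hxy
      simp only [Set.indicator, Set.mem_ofPred_eq, hat hxy]
    · intro x y hxy
      exact hxy _ (by simp)
  have := hindep.integral_mul_eq_mul_integral (hone j).aestronglyMeasurable
    (measurable_pi_apply _).aestronglyMeasurable
  simp only [Pi.mul_apply] at this
  rw [this, integral_reward, integral_mul_const]

theorem integrable_totalReward (hν : IsInstance ν) {S : Strategy N K}
    (hS : ∀ t i, Measurable fun x => (S x t).arm i) (T : ℕ) :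
    Integrable (totalReward S T) (rewardLaw ν) :=
  integrable_finsetSum _ fun t _ => integrable_finsetSum _ fun i _ =>
    integrable_reward_arm hν (hS t i) t i

/-- The regret of a strategy when the mean rewards are `μ` and the table of rewards is `x`. -/
noncomputable def pseudoRegret (μ : Fin N → Fin K → ℝ) (S : Strategy N K) (T : ℕ)
    (x : RewardTable N K) : ℝ :=
  ∑ t ∈ Finset.range T, ∑ i, ((⨆ j, μ i j) - μ i ((S x t).arm i))

variable (ν) in
theorem integrable_mean_arm {a : RewardTable N K → Fin K} (ha : Measurable a) (i : Fin N) :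
    Integrable (fun x => meanReward ν i (a x)) (rewardLaw ν) := by
  obtain ⟨B, hB⟩ := (Set.finite_range (fun j => ‖meanReward ν i j‖)).bddAbove
  exact Integrable.of_bound
    ((Measurable.of_discrete (f := meanReward ν i)).comp ha).aestronglyMeasurable B
    (Filter.Eventually.of_forall fun x => hB ⟨a x, rfl⟩)

variable (ν) in
theorem integrable_pseudoRegret {S : Strategy N K}
    (hS : ∀ t i, Measurable fun x => (S x t).arm i) (T : ℕ) :
    Integrable (pseudoRegret (meanReward ν) S T) (rewardLaw ν) :=
  integrable_finsetSum _ fun t _ => integrable_finsetSum _ fun i _ =>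
    (integrable_const _).sub (integrable_mean_arm ν (hS t i) i)

theorem regret_eq_integral_pseudoRegret (hν : IsInstance ν) {S : Strategy N K}
    (hS : ∀ t i, Measurable fun x => (S x t).arm i)
    (hdep : ∀ t i, DependsOnRounds (fun x => (S x t).arm i) (Finset.range t)) (T : ℕ) :
    regret ν S T = ∫ x, pseudoRegret (meanReward ν) S T x ∂(rewardLaw ν) := by
  have hgap : ∀ t i, Integrable
      (fun x => (⨆ j, meanReward ν i j) - meanReward ν i ((S x t).arm i)) (rewardLaw ν) :=
    fun t i => (integrable_const _).sub (integrable_mean_arm ν (hS t i) i)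
  unfold regret totalReward pseudoRegret
  rw [integral_finsetSum _ fun t _ => integrable_finsetSum _ fun i _ =>
      integrable_reward_arm hν (hS t i) t i,
    integral_finsetSum _ fun t _ => integrable_finsetSum _ fun i _ => hgap t i]
  have h : ∀ t ∈ Finset.range T,
      ∫ x, ∑ i, ((⨆ j, meanReward ν i j) - meanReward ν i ((S x t).arm i)) ∂(rewardLaw ν) =
      ∑ i, (⨆ j, meanReward ν i j) - ∫ x, ∑ i, x (t, i, (S x t).arm i) ∂(rewardLaw ν) := by
    intro t _
    rw [integral_finsetSum _ fun i _ => hgap t i,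
      integral_finsetSum _ fun i _ => integrable_reward_arm hν (hS t i) t i,
      ← Finset.sum_sub_distrib]
    refine Finset.sum_congr rfl fun i _ => ?_
    rw [integral_sub (integrable_const _) (integrable_mean_arm ν (hS t i) i),
      integral_reward_arm hν (hS t i) t i (hdep t i)]
    simp
  rw [Finset.sum_congr rfl h, Finset.sum_sub_distrib]
  simp

end Law

/-! ### Concentration of the estimates -/

theorem HasSubgaussianMGF.mono_param {Ω : Type*} [MeasurableSpace Ω] {X : Ω → ℝ} {c d : ℝ≥0}
    {P : Measure Ω} (h : HasSubgaussianMGF X c P) (hcd : c ≤ d) : HasSubgaussianMGF X d P where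
  integrable_exp_mul := h.integrable_exp_mul
  mgf_le t := (h.mgf_le t).trans (Real.exp_le_exp.2 (by gcongr))

theorem lintegral_exp_le_one {Ω : Type*} [MeasurableSpace Ω] {X : Ω → ℝ} {c : ℝ≥0}
    {P : Measure Ω} (h : HasSubgaussianMGF X c P) (l : ℝ) :
    ∫⁻ x, ENNReal.ofReal (Real.exp (l * X x - c * l ^ 2 / 2)) ∂P ≤ 1 := by
  have h1 : Integrable (fun x => Real.exp (l * X x - c * l ^ 2 / 2)) P := by
    simp only [sub_eq_add_neg, Real.exp_add]
    exact (h.integrable_exp_mul l).mul_const _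
  rw [← ofReal_integral_eq_lintegral_ofReal h1
    (Filter.Eventually.of_forall fun x => (Real.exp_pos _).le)]
  refine ENNReal.ofReal_le_one.2 ?_
  simp only [sub_eq_add_neg, Real.exp_add]
  rw [integral_mul_const]
  calc (∫ x, Real.exp (l * X x) ∂P) * Real.exp (-(c * l ^ 2 / 2))
      ≤ Real.exp (c * l ^ 2 / 2) * Real.exp (-(c * l ^ 2 / 2)) :=
        mul_le_mul_of_nonneg_right (h.mgf_le l) (Real.exp_pos _).le
    _ = 1 := by rw [← Real.exp_add]; simp

/-- A partition of the integral by the values of a countable parameter. If, given the value `c` of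
the parameter, `W` is independent of the factor `V c` whose mean is at most `1`, then the factor
does not increase the integral. -/
theorem lintegral_mul_le_of_indepFun {Ω ι : Type*} [MeasurableSpace Ω] [MeasurableSpace ι]
    [DiscreteMeasurableSpace ι] [Countable ι] {P : Measure Ω} {d : Ω → ι} (hd : Measurable d)
    {W : Ω → ℝ≥0∞} (hW : Measurable W) {V : ι → Ω → ℝ≥0∞} (hV : ∀ c, Measurable (V c))
    (hind : ∀ c, IndepFun ((d ⁻¹' {c}).indicator W) (V c) P) (hone : ∀ c, ∫⁻ x, V c x ∂P ≤ 1) :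
    ∫⁻ x, W x * V (d x) x ∂P ≤ ∫⁻ x, W x ∂P := by
  have hWc : ∀ c, Measurable ((d ⁻¹' {c}).indicator W) :=
    fun c => hW.indicator (hd (measurableSet_singleton c))
  have hsplit : ∀ F : ι → ℝ≥0∞, ∀ x, ∑' c, (d ⁻¹' {c}).indicator W x * F c = W x * F (d x) := by
    intro F x
    rw [tsum_eq_single (d x)]
    · simp
    · intro c hc
      simp [Ne.symm hc]
  calc ∫⁻ x, W x * V (d x) x ∂P
      = ∫⁻ x, ∑' c, (d ⁻¹' {c}).indicator W x * V c x ∂P :=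
        lintegral_congr fun x => (hsplit (fun c => V c x) x).symm
    _ = ∑' c, ∫⁻ x, (d ⁻¹' {c}).indicator W x * V c x ∂P :=
        lintegral_tsum fun c => ((hWc c).mul (hV c)).aemeasurable
    _ = ∑' c, (∫⁻ x, (d ⁻¹' {c}).indicator W x ∂P) * ∫⁻ x, V c x ∂P := by
        congr 1
        funext c
        exact lintegral_mul_eq_lintegral_mul_lintegral_of_indepFun (hWc c) (hV c) (hind c)
    _ ≤ ∑' c, ∫⁻ x, (d ⁻¹' {c}).indicator W x ∂P :=
        ENNReal.tsum_le_tsum fun c => mul_le_of_le_one_right' (hone c)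
    _ = ∫⁻ x, ∑' c, (d ⁻¹' {c}).indicator W x * 1 ∂P := by
        simp only [mul_one]
        exact (lintegral_tsum fun c => (hWc c).aemeasurable).symm
    _ = ∫⁻ x, W x ∂P := lintegral_congr fun x => (hsplit (fun _ => 1) x).trans (mul_one _)

section Law

variable {ν : Fin N → Fin K → Measure ℝ} [∀ i j, IsProbabilityMeasure (ν i j)]

theorem measurable_groupReward (t : ℕ) (π : Fin N → Fin K) (G : Finset (Fin N)) :
    Measurable (fun x => groupReward x t π G) := by
  unfold groupReward; fun_prop

theorem dependsOnRounds_groupReward (t : ℕ) (π : Fin N → Fin K) (G : Finset (Fin N)) :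
    DependsOnRounds (fun x => groupReward x t π G) {t} :=
  fun _ _ h => Finset.sum_congr rfl fun _ _ => h _ rfl

theorem hasSubgaussianMGF_groupReward (hν : IsInstance ν) (t : ℕ) (π : Fin N → Fin K)
    (G : Finset (Fin N)) :
    HasSubgaussianMGF (fun x => groupReward x t π G - ∑ i ∈ G, meanReward ν i (π i)) G.card
      (rewardLaw ν) := by
  have hinj : Function.Injective (fun i : Fin N => ((t, i, π i) : ℕ × Fin N × Fin K)) :=
    fun a b h => by simpa using congrArg (fun p : ℕ × Fin N × Fin K => p.2.1) h
  have h1 : iIndepFun (fun (i : Fin N) (x : RewardTable N K) =>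
      x (t, i, π i) - meanReward ν i (π i)) (rewardLaw ν) :=
    ((iIndepFun_reward ν).precomp hinj).comp (fun i r => r - meanReward ν i (π i))
      fun i => by fun_prop
  have h2 := HasSubgaussianMGF.sum_of_iIndepFun h1 (c := fun _ => 1) (s := G)
    fun i _ => hasSubgaussianMGF_reward hν (t, i, π i)
  simpa [groupReward, Finset.sum_sub_distrib] using h2

/-- The estimate from a group `G` is `(4 C + 1)`-subgaussian around the mean reward: the rewards
of the other users in the two rounds have the same means, and at most `2 |G| - 1` rewards enter. -/
theorem hasSubgaussianMGF_estimate (hν : IsInstance ν) {C : ℕ} (𝒢 : Grouping N K C) (s : ℕ)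
    {π : Fin N → Fin K} {i : Fin N} (h : Informative C π i (π i)) :
    HasSubgaussianMGF (fun x => 𝒢.estimate x s π i - meanReward ν i (π i)) (4 * C + 1)
      (rewardLaw ν) := by
  have hpos := (𝒢.pos_mem π i h).1
  have hmem := 𝒢.mem π i h
  have hcard := 𝒢.card_le π i h
  have hind : IndepFun
      (fun x => groupReward x s π (𝒢.grp π i) - ∑ i' ∈ 𝒢.grp π i, meanReward ν i' (π i'))
      (fun x => groupReward x (s + 𝒢.pos π i) π ((𝒢.grp π i).erase i) -
        ∑ i' ∈ (𝒢.grp π i).erase i, meanReward ν i' (π i')) (rewardLaw ν) := by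
    refine indepFun_of_disjoint_rounds ν (S := {s}) (T := {s + 𝒢.pos π i}) (by simp; omega)
      ((measurable_groupReward _ _ _).sub_const _) ((measurable_groupReward _ _ _).sub_const _)
      ?_ ?_
    · simpa using (dependsOnRounds_groupReward s π (𝒢.grp π i)).comp_left
        (fun r => r - ∑ i' ∈ 𝒢.grp π i, meanReward ν i' (π i'))
    · simpa using (dependsOnRounds_groupReward (s + 𝒢.pos π i) π
        ((𝒢.grp π i).erase i)).comp_left
        (fun r => r - ∑ i' ∈ (𝒢.grp π i).erase i, meanReward ν i' (π i'))
  have h1 := (hasSubgaussianMGF_groupReward hν s π (𝒢.grp π i)).sub_of_indepFun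
    (hasSubgaussianMGF_groupReward hν (s + 𝒢.pos π i) π ((𝒢.grp π i).erase i)) hind
  have h2 : (fun x => 𝒢.estimate x s π i - meanReward ν i (π i)) = fun x =>
      (groupReward x s π (𝒢.grp π i) - ∑ i' ∈ 𝒢.grp π i, meanReward ν i' (π i')) -
      (groupReward x (s + 𝒢.pos π i) π ((𝒢.grp π i).erase i) -
        ∑ i' ∈ (𝒢.grp π i).erase i, meanReward ν i' (π i')) := by
    funext x
    unfold Grouping.estimate
    rw [𝒢.without_zero h, 𝒢.without_pos h,
      ← Finset.add_sum_erase (𝒢.grp π i) (fun i' => meanReward ν i' (π i')) hmem]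
    ring
  rw [h2]
  refine HasSubgaussianMGF.mono_param h1 ?_
  rw [Finset.card_erase_of_mem hmem]
  have : (𝒢.grp π i).card + ((𝒢.grp π i).card - 1) ≤ 4 * C + 1 := by omega
  exact_mod_cast this

theorem dependsOnRounds_estimate {C : ℕ} (𝒢 : Grouping N K C) (s : ℕ)
    {π : Fin N → Fin K} {i : Fin N} (h : Informative C π i (π i)) :
    DependsOnRounds (fun x => 𝒢.estimate x s π i) (Finset.Ico s (s + (2 * C + 2))) := by
  have h1 := (𝒢.pos_mem π i h).2
  have h2 := 𝒢.card_le π i h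
  intro x y hxy
  refine congrArg₂ _ (dependsOnRounds_groupReward _ _ _ fun p hp => hxy p ?_)
    (dependsOnRounds_groupReward _ _ _ fun p hp => hxy p ?_)
  · have : p.1 = s := hp
    simp [this]
  · have : p.1 = s + 𝒢.pos π i := hp
    simp [this]
    omega

/-- The estimates from different runs of the sub-algorithm are independent. -/
theorem hasSubgaussianMGF_sum_estimate (hν : IsInstance ν) {C : ℕ} (𝒢 : Grouping N K C) (s : ℕ)
    (π : ℕ → Fin N → Fin K) (i : Fin N) (j : Fin K) (R : Finset ℕ)
    (hR : ∀ r ∈ R, π r i = j ∧ Informative C (π r) i (π r i)) :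
    HasSubgaussianMGF (fun x => ∑ r ∈ R, 𝒢.estimate x (s + (2 * C + 2) * r) (π r) i -
      R.card * meanReward ν i j) (R.card * (4 * C + 1)) (rewardLaw ν) := by
  induction R using Finset.induction_on with
  | empty => simp
  | insert a R ha ih =>
    have hRa := hR a (Finset.mem_insert_self _ _)
    have hR' : ∀ r ∈ R, π r i = j ∧ Informative C (π r) i (π r i) :=
      fun r hr => hR r (Finset.mem_insert_of_mem hr)
    have h1 := hasSubgaussianMGF_estimate hν 𝒢 (s + (2 * C + 2) * a) hRa.2
    rw [hRa.1] at h1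
    have hind : IndepFun
        (fun x => 𝒢.estimate x (s + (2 * C + 2) * a) (π a) i - meanReward ν i j)
        (fun x => ∑ r ∈ R, 𝒢.estimate x (s + (2 * C + 2) * r) (π r) i -
          R.card * meanReward ν i j) (rewardLaw ν) := by
      refine indepFun_of_disjoint_rounds ν
        (S := Finset.Ico (s + (2 * C + 2) * a) (s + (2 * C + 2) * a + (2 * C + 2)))
        (T := R.biUnion fun r =>
          Finset.Ico (s + (2 * C + 2) * r) (s + (2 * C + 2) * r + (2 * C + 2))) ?_
        ((measurable_estimate _ _ _ _).sub_const _)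
        ((Finset.measurable_fun_sum _ fun _ _ => measurable_estimate _ _ _ _).sub_const _) ?_ ?_
      · rw [Finset.disjoint_biUnion_right]
        intro r hr
        rw [Finset.disjoint_left]
        intro t ht ht'
        rw [Finset.mem_Ico] at ht ht'
        have hdiv : ∀ r, s + (2 * C + 2) * r ≤ t ∧ t < s + (2 * C + 2) * r + (2 * C + 2) →
            (t - s) / (2 * C + 2) = r := by
          intro r hr
          rw [Nat.div_eq_iff (by omega)]
          rw [mul_comm r]
          omega
        exact ha (((hdiv a ht).symm.trans (hdiv r ht')) ▸ hr)
      · exact (dependsOnRounds_estimate 𝒢 _ hRa.2).comp_left (fun r => r - meanReward ν i j)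
      · refine DependsOnRounds.comp_left (dependsOnRounds_finset_sum R fun r hr =>
          (dependsOnRounds_estimate 𝒢 _ (hR' r hr).2).mono ?_)
          (fun r => r - R.card * meanReward ν i j)
        intro t ht
        rw [Finset.mem_coe] at ht ⊢
        exact Finset.mem_biUnion.2 ⟨r, hr, ht⟩
    have h2 := h1.add_of_indepFun (ih hR') hind
    rw [Finset.card_insert_of_notMem ha]
    convert h2 using 1
    · funext x
      rw [Finset.sum_insert ha]
      push_cast
      ring
    · push_cast
      ring

end Law

/-! ### The exponential supermartingale and the bad event -/

namespace Input

variable (I : Input N K) (γ : ℝ)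

theorem dependsOnRounds_arm (t : ℕ) (i : Fin N) :
    DependsOnRounds (fun x => (I.strategy γ x t).arm i) (Finset.range t) := by
  intro x y hxy
  have := I.strategy_eq_of_feedback (γ := γ) (t := t) (x := x) (y := y)
    (I.feedback_eq_of_agree fun p hp => hxy p (by simpa using hp))
  simp only [this]

/-- The logarithm of the exponential supermartingale that controls the sum of the estimates of user
`i` at arm `j`, where `m` is the mean reward. -/
noncomputable def potential (l m : ℝ) (i : Fin N) (j : Fin K) (s : State N K) : ℝ :=
  l * (s.sum i j - s.count i j * m) - s.count i j * (4 * I.C + 1) * l ^ 2 / 2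

theorem measurable_potential (l m : ℝ) (i : Fin N) (j : Fin K) (b : ℕ) :
    Measurable (fun x => I.potential l m i j (I.state γ x b)) := by
  have h1 := (I.measurable_state γ b).2 i j
  have h2 : Measurable (fun x => ((I.state γ x b).count i j : ℝ)) :=
    (Measurable.of_discrete (f := fun n : ℕ => (n : ℝ))).comp (I.measurable_count γ b i j)
  unfold potential
  exact ((h1.sub (h2.mul_const _)).const_mul _).sub
    (((h2.mul_const _).mul_const _).div_const _)

/-- What happens up to the random start of a batch depends only on earlier rounds. -/
theorem dependsOnRounds_indicator_state {β : Type*} [Zero β] (f : State N K → β)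
    (c : DiscreteState N K) {b : ℕ} (hb : b ≤ I.batches) :
    DependsOnRounds (((fun x => (I.state γ x b).discrete) ⁻¹' {c}).indicator
      (fun x => f (I.state γ x b))) (Finset.range c.1) := by
  have key : ∀ x y : RewardTable N K, (∀ p : ℕ × Fin N × Fin K, p.1 < c.1 → x p = y p) →
      (I.state γ x b).discrete = c → I.state γ x b = I.state γ y b := by
    intro x y hxy hx
    refine I.state_eq_of_feedback (I.feedback_eq_of_agree hxy) hb ?_
    rw [← hx]
    exact le_rfl
  intro x y hxy
  have hxy' : ∀ p : ℕ × Fin N × Fin K, p.1 < c.1 → x p = y p :=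
    fun p hp => hxy p (by simpa using hp)
  simp only [Set.indicator, Set.mem_preimage, Set.mem_singleton_iff]
  by_cases hx : (I.state γ x b).discrete = c
  · rw [← key x y hxy' hx]
  · have hy : (I.state γ y b).discrete ≠ c := by
      intro hy
      exact hx (by rw [← key y x (fun p hp => (hxy' p hp).symm) hy]; exact hy)
    simp [hx, hy]

section Law

variable {ν : Fin N → Fin K → Measure ℝ} [∀ i j, IsProbabilityMeasure (ν i j)]

/-- The exponential supermartingale: given the state at the start of a batch, the estimates of the
batch come from fresh rewards. -/
theorem lintegral_exp_potential_le_one (hν : IsInstance ν) (l : ℝ) (i : Fin N) (j : Fin K)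
    (b : ℕ) (hb : b ≤ I.batches) :
    ∫⁻ x, ENNReal.ofReal (Real.exp (I.potential l (meanReward ν i j) i j (I.state γ x b)))
      ∂(rewardLaw ν) ≤ 1 := by
  classical
  induction b with
  | zero => simp [potential, state]
  | succ b ih =>
    refine le_trans ?_ (ih (by omega))
    set m := meanReward ν i j with hm
    let smp : DiscreteState N K → Finset ℕ := fun c =>
      I.sampled (I.decomposition b c.toState) (I.batchSize b) c.toState.active i j
    let V : DiscreteState N K → RewardTable N K → ℝ≥0∞ := fun c x =>
      if I.stops b c.toState then 1 else ENNReal.ofReal (Real.exp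
        (l * (I.batchSum b c.toState i j x - (smp c).card * m) -
          ((smp c).card * (4 * I.C + 1) : ℝ≥0) * l ^ 2 / 2))
    have hsmp : ∀ c, ∀ r ∈ smp c, (I.decomposition b c.toState).assign r i = j ∧
        Informative I.C ((I.decomposition b c.toState).assign r) i
          ((I.decomposition b c.toState).assign r i) :=
      fun c r hr => (I.mem_sampled hr).2
    have hV : ∀ c, Measurable (V c) := by
      intro c
      by_cases hc : I.stops b c.toState
      · simp only [V, hc, if_true]; exact measurable_const
      · simp only [V, hc, if_false]
        have := I.measurable_batchSum b c.toState i j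
        fun_prop
    have hstep : ∀ x, ENNReal.ofReal (Real.exp (I.potential l m i j (I.state γ x (b + 1)))) =
        ENNReal.ofReal (Real.exp (I.potential l m i j (I.state γ x b))) *
          V (I.state γ x b).discrete x := by
      intro x
      by_cases hx : I.stops b (I.state γ x b)
      · rw [state_succ_of_stops I hx]
        rw [stops_iff] at hx
        simp only [V, hx, if_true, mul_one]
        rfl
      · rw [state_succ_of_not_stops I hx, afterBatch_eq]
        rw [stops_iff] at hx
        simp only [V, hx, if_false]
        rw [← ENNReal.ofReal_mul (Real.exp_pos _).le, ← Real.exp_add]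
        congr 2
        simp only [potential, nextSum_eq]
        have : (I.nextCount b (I.state γ x b) i j : ℝ) = (I.state γ x b).count i j +
            (smp (I.state γ x b).discrete).card := by
          unfold nextCount; push_cast; rfl
        rw [this]
        push_cast
        ring
    rw [lintegral_congr hstep]
    refine lintegral_mul_le_of_indepFun (I.measurable_state γ b).1
      (I.measurable_potential γ l m i j b).exp.ennreal_ofReal hV ?_ ?_
    · intro c
      refine indepFun_of_disjoint_rounds ν (S := Finset.range c.1)
        (T := (smp c).biUnion fun r => Finset.Ico (c.1 + (2 * I.C + 2) * r)
          (c.1 + (2 * I.C + 2) * r + (2 * I.C + 2))) ?_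
        (((I.measurable_potential γ l m i j b).exp.ennreal_ofReal).indicator
          ((I.measurable_state γ b).1 (measurableSet_singleton c))) (hV c)
        (I.dependsOnRounds_indicator_state γ
          (fun s => ENNReal.ofReal (Real.exp (I.potential l m i j s))) c (by omega)) ?_
      · rw [Finset.disjoint_biUnion_right]
        intro r _
        rw [Finset.disjoint_left]
        intro t ht ht'
        rw [Finset.mem_range] at ht
        rw [Finset.mem_Ico] at ht'
        omega
      · have h1 : DependsOnRounds (I.batchSum b c.toState i j)
            ((smp c).biUnion fun r => Finset.Ico (c.1 + (2 * I.C + 2) * r)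
              (c.1 + (2 * I.C + 2) * r + (2 * I.C + 2)) : Finset ℕ) := by
          refine dependsOnRounds_finset_sum _ fun r hr =>
            (dependsOnRounds_estimate I.grouping _ (hsmp c r hr).2).mono ?_
          intro t ht
          rw [Finset.mem_coe] at ht ⊢
          exact Finset.mem_biUnion.2 ⟨r, hr, ht⟩
        intro x y hxy
        simp only [V, h1 hxy]
    · intro c
      by_cases hc : I.stops b c.toState
      · simp only [V, hc, if_true]; simp
      · simp only [V, hc, if_false]
        exact lintegral_exp_le_one (hasSubgaussianMGF_sum_estimate hν I.grouping c.1
          (I.decomposition b c.toState).assign i j (smp c) (hsmp c)) l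

/-- Chernoff bound for a one-sided deviation; `l` determines the side. -/
theorem measure_potential_le (hν : IsInstance ν) (l a : ℝ) (i : Fin N) (j : Fin K) {b : ℕ}
    (hb : b ≤ I.batches) :
    (rewardLaw ν).real {x | a ≤ I.potential l (meanReward ν i j) i j (I.state γ x b)} ≤
      Real.exp (-a) := by
  have h1 := mul_meas_ge_le_lintegral (μ := rewardLaw ν)
    (I.measurable_potential γ l (meanReward ν i j) i j b).exp.ennreal_ofReal
    (ENNReal.ofReal (Real.exp a))
  have h2 : {x | ENNReal.ofReal (Real.exp a) ≤ ENNReal.ofReal (Real.exp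
      (I.potential l (meanReward ν i j) i j (I.state γ x b)))} =
      {x | a ≤ I.potential l (meanReward ν i j) i j (I.state γ x b)} := by
    ext x
    exact (ENNReal.ofReal_le_ofReal_iff (Real.exp_pos _).le).trans Real.exp_le_exp
  rw [h2] at h1
  have h3 := h1.trans (I.lintegral_exp_potential_le_one γ hν l i j b hb)
  rw [← ofReal_measureReal (measure_ne_top _ _),
    ← ENNReal.ofReal_mul (Real.exp_pos _).le, ENNReal.ofReal_le_one] at h3
  rw [Real.exp_neg, ← one_div, le_div_iff₀ (Real.exp_pos _), mul_comm]
  exact h3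

/-- The estimated mean of `(i, j)` deviates by half of the elimination threshold before the batch
with index `b`, and it is based on `n` samples. -/
def deviationEvent (μ : Fin N → Fin K → ℝ) (b : ℕ) (i : Fin N) (j : Fin K) (n : ℕ) :
    Set (RewardTable N K) :=
  {x | (I.state γ x b).count i j = n ∧
    n * (√(γ / n) / 2) ≤ |(I.state γ x b).sum i j - n * μ i j|}

theorem measurableSet_deviationEvent (μ : Fin N → Fin K → ℝ) (b : ℕ) (i : Fin N) (j : Fin K)
    (n : ℕ) : MeasurableSet (I.deviationEvent γ μ b i j n) := by
  refine MeasurableSet.inter (I.measurable_count γ b i j (measurableSet_singleton n)) ?_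
  exact measurableSet_le measurable_const
    (((I.measurable_state γ b).2 i j).sub_const _).abs

variable {γ} in
theorem measure_deviationEvent_le (hν : IsInstance ν) (hγ : 0 ≤ γ) {b : ℕ} (hb : b ≤ I.batches)
    (i : Fin N) (j : Fin K) {n : ℕ} (hn : 1 ≤ n) :
    (rewardLaw ν).real (I.deviationEvent γ (meanReward ν) b i j n) ≤
      2 * Real.exp (-(γ / (8 * (4 * I.C + 1)))) := by
  have hnR : (0 : ℝ) < n := by exact_mod_cast hn
  have hv : (0 : ℝ) < 4 * I.C + 1 := by positivity
  set ε := √(γ / n) / 2 with hε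
  have hε0 : 0 ≤ ε := by positivity
  have hε2 : ε ^ 2 = γ / n / 4 := by
    rw [hε, div_pow, Real.sq_sqrt (by positivity)]; norm_num
  -- The optimal exponent of the Chernoff bound.
  set l := ε / (4 * I.C + 1) with hl
  have hl0 : 0 ≤ l := by positivity
  set a := γ / (8 * (4 * (I.C : ℝ) + 1)) with ha
  have hval : l * (n * ε) - n * (4 * I.C + 1) * l ^ 2 / 2 = a := by
    have : l * (n * ε) - n * (4 * I.C + 1) * l ^ 2 / 2 = n * ε ^ 2 / (2 * (4 * I.C + 1)) := by
      rw [hl]; field_simp; ring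
    rw [this, hε2, ha]
    field_simp
    ring
  have hsub : I.deviationEvent γ (meanReward ν) b i j n ⊆
      {x | a ≤ I.potential l (meanReward ν i j) i j (I.state γ x b)} ∪
      {x | a ≤ I.potential (-l) (meanReward ν i j) i j (I.state γ x b)} := by
    rintro x ⟨h1, h2⟩
    simp only [Set.mem_union, Set.mem_ofPred_eq, potential, h1]
    rw [← hε] at h2
    rcases le_abs.1 h2 with h | h
    · left
      have := mul_le_mul_of_nonneg_left h hl0
      linarith
    · right
      have := mul_le_mul_of_nonneg_left h hl0
      rw [neg_sq]
      linarith
  calc (rewardLaw ν).real (I.deviationEvent γ (meanReward ν) b i j n)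
      ≤ _ := measureReal_mono hsub
    _ ≤ _ := measureReal_union_le _ _
    _ ≤ Real.exp (-a) + Real.exp (-a) := add_le_add (I.measure_potential_le γ hν l a i j hb)
        (I.measure_potential_le γ hν (-l) a i j hb)
    _ = 2 * Real.exp (-a) := by ring

/-- Some estimated mean that is based on at most `n` samples deviates. -/
def badEvent (μ : Fin N → Fin K → ℝ) (n : ℕ) : Set (RewardTable N K) :=
  ⋃ q ∈ Finset.range (I.batches + 1) ×ˢ (Finset.univ : Finset (Fin N)) ×ˢ
    (Finset.univ : Finset (Fin K)) ×ˢ Finset.Icc 1 n,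
    I.deviationEvent γ μ q.1 q.2.1 q.2.2.1 q.2.2.2

theorem measurableSet_badEvent (μ : Fin N → Fin K → ℝ) (n : ℕ) :
    MeasurableSet (I.badEvent γ μ n) :=
  Finset.measurableSet_biUnion _ fun _ _ => I.measurableSet_deviationEvent γ μ _ _ _ _

variable {γ} in
theorem measure_badEvent_le (hν : IsInstance ν) (hγ : 0 ≤ γ) (n : ℕ) :
    (rewardLaw ν).real (I.badEvent γ (meanReward ν) n) ≤
      (I.batches + 1) * N * K * n * (2 * Real.exp (-(γ / (8 * (4 * I.C + 1))))) := by
  refine (measureReal_biUnion_finset_le _ _).trans ?_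
  refine (Finset.sum_le_card_nsmul _ _ (2 * Real.exp (-(γ / (8 * (4 * I.C + 1)))))
    fun q hq => ?_).trans_eq ?_
  · simp only [Finset.mem_product, Finset.mem_range, Finset.mem_Icc] at hq
    exact I.measure_deviationEvent_le hν hγ (by omega) _ _ hq.2.2.2.1
  · simp only [Finset.card_product, Finset.card_range, Finset.card_univ, Fintype.card_fin,
      Nat.card_Icc, Nat.add_sub_cancel, nsmul_eq_mul]
    push_cast
    ring

variable {γ} in
theorem abs_sub_lt_of_notMem_badEvent {μ : Fin N → Fin K → ℝ} {n : ℕ} {x : RewardTable N K}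
    (hx : x ∉ I.badEvent γ μ n) {b : ℕ} (hb : b ≤ I.batches) (i : Fin N) (j : Fin K)
    (h1 : 1 ≤ (I.state γ x b).count i j) (h2 : (I.state γ x b).count i j ≤ n) :
    |(I.state γ x b).sum i j / (I.state γ x b).count i j - μ i j| <
      √(γ / (I.state γ x b).count i j) / 2 := by
  by_contra hlt
  refine hx (Set.mem_biUnion (x := (b, i, j, (I.state γ x b).count i j)) ?_ ⟨rfl, ?_⟩)
  · simp only [Finset.coe_product, Set.mem_prod, Finset.mem_coe, Finset.mem_range,
      Finset.mem_univ, Finset.mem_Icc, true_and]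
    omega
  · have hpos : (0 : ℝ) < (I.state γ x b).count i j := by exact_mod_cast h1
    refine (mul_le_mul_of_nonneg_left (not_lt.1 hlt) hpos.le).trans_eq ?_
    simp only
    rw [← abs_of_pos hpos, ← abs_mul, abs_of_pos hpos, mul_sub, mul_div_cancel₀ _ hpos.ne']

end Law

end Input

/-! ### The grid -/

section Grid

variable {H : ℝ} {B b : ℕ}

theorem gridPoint_zero : gridPoint H B 0 = 0 := by simp [gridPoint]

theorem gridPoint_of_lt (hb : 1 ≤ b) (hbB : b < B) :
    gridPoint H B b = H ^ (1 - 1 / (2 : ℝ) ^ b) := by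
  have : b ≠ 0 := by omega
  simp [gridPoint, this, hbB]

theorem gridPoint_last (hB : 1 ≤ B) : gridPoint H B B = H := by
  have : B ≠ 0 := by omega
  simp [gridPoint, this]

theorem gridPoint_le (hH : 1 ≤ H) : gridPoint H B b ≤ H := by
  unfold gridPoint
  split_ifs
  · linarith
  · refine (Real.rpow_le_rpow_of_exponent_le hH (y := 1 - 1 / (2 : ℝ) ^ b) (z := 1) ?_).trans_eq
      (Real.rpow_one H)
    have : (0 : ℝ) ≤ 1 / 2 ^ b := by positivity
    linarith
  · exact le_rfl

theorem gridPoint_pos (hH : 1 < H) (hb : 1 ≤ b) : 0 < gridPoint H B b := by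
  have h0 : b ≠ 0 := by omega
  have hH0 : 0 < H := by linarith
  simp only [gridPoint, h0, if_false]
  split_ifs
  · positivity
  · exact hH0

theorem gridPoint_lt_succ (hH : 1 < H) (hb : b < B) :
    gridPoint H B b < gridPoint H B (b + 1) := by
  rcases Nat.eq_zero_or_pos b with rfl | hb0
  · rw [gridPoint_zero]
    exact gridPoint_pos hH le_rfl
  · rw [gridPoint_of_lt hb0 hb]
    rcases Nat.lt_or_ge (b + 1) B with h | h
    · rw [gridPoint_of_lt (by omega) h]
      refine Real.rpow_lt_rpow_of_exponent_lt hH ?_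
      have : (1 : ℝ) / 2 ^ (b + 1) < 1 / 2 ^ b :=
        one_div_lt_one_div_of_lt (by positivity) (pow_lt_pow_right₀ (by norm_num) (by omega))
      linarith
    · have : b + 1 = B := by omega
      rw [this, gridPoint_last (by omega)]
      conv_rhs => rw [← Real.rpow_one H]
      refine Real.rpow_lt_rpow_of_exponent_lt hH ?_
      have : (0 : ℝ) < 1 / 2 ^ b := by positivity
      linarith

end Grid

/-! ### The run of the algorithm outside the bad event -/

/-- Of the numbers below `n` that satisfy `p`, the first `k` are `min k m` many if there are `m`. -/
theorem card_filter_first (p : ℕ → Prop) [DecidablePred p] (k n : ℕ) :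
    ((Finset.range n).filter (fun r => p r ∧
      ((Finset.range r).filter p).card < k)).card = min k ((Finset.range n).filter p).card := by
  induction n with
  | zero => simp
  | succ n ih =>
    rw [Finset.range_add_one, Finset.filter_insert, Finset.filter_insert]
    by_cases hp : p n
    · by_cases hk : ((Finset.range n).filter p).card < k
      · rw [if_pos ⟨hp, hk⟩, if_pos hp, Finset.card_insert_of_notMem (by simp),
          Finset.card_insert_of_notMem (by simp), ih]
        omega
      · rw [if_neg (fun h => hk h.2), if_pos hp, Finset.card_insert_of_notMem (by simp), ih]
        omega
    · rw [if_neg (fun h => hp h.1), if_neg hp, ih]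

namespace Input

variable (I : Input N K)

theorem card_sampled {M : AssignmentSeq N K} {D : ℝ} {A : Fin N → Finset (Fin K)}
    (hM : M.IsDecomposition I.C (batchedWeight D A)) (i : Fin N) (j : Fin K) :
    (I.sampled M D A i j).card = ⌈batchedWeight D A i j⌉₊ := by
  classical
  have h := card_filter_first (fun r => Informative I.C (M.assign r) i j)
    ⌈batchedWeight D A i j⌉₊ M.len
  rw [min_eq_left (Nat.ceil_le.2 (by convert hM.informative i j))] at h
  rw [← h]
  unfold sampled
  congr!

/-- The properties of the state before the batch with index `b` that persist outside the bad
event, for the means `μ` and the optimal arms `jopt`. -/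
structure GoodState (γ : ℝ) (μ : Fin N → Fin K → ℝ) (jopt : Fin N → Fin K) (b : ℕ)
    (s : State N K) : Prop where
  not_aborted : ¬ s.aborted
  opt_mem : ∀ i, jopt i ∈ s.active i
  count_eq : ∀ i, ∀ j ∈ s.active i, s.count i j = s.count i (jopt i)
  le_count : ∀ i, gridPoint I.horizon I.batches b / K ≤ s.count i (jopt i)
  count_le : ∀ i, (s.count i (jopt i) : ℝ) ≤ gridPoint I.horizon I.batches b + b
  gap_le : 1 ≤ b → ∀ i, ∀ j ∈ s.active i,
    μ i (jopt i) - μ i j ≤ 2 * √(γ * K / gridPoint I.horizon I.batches b)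

variable {I} {γ c : ℝ} {μ : Fin N → Fin K → ℝ} {jopt : Fin N → Fin K} {b n : ℕ}
  {x : RewardTable N K}

theorem isUBatched_of_opt_mem (hH : 1 < I.horizon)
    (hU : ∀ j, I.U ≤ (Finset.univ.filter (fun i => jopt i = j)).card) (hb : b < I.batches)
    {A : Fin N → Finset (Fin K)} (hA : ∀ i, jopt i ∈ A i) :
    IsUBatched I.U (I.batchSize b) A where
  pos := sub_pos.2 (gridPoint_lt_succ hH hb)
  nonempty := fun i => ⟨jopt i, hA i⟩
  assignment := ⟨jopt, hA, hU⟩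

theorem GoodState.not_stops (hH : 1 < I.horizon)
    (hU : ∀ j, I.U ≤ (Finset.univ.filter (fun i => jopt i = j)).card) (hb : b < I.batches)
    {s : State N K} (h : I.GoodState γ μ jopt b s) : ¬ I.stops b s :=
  not_or.2 ⟨h.not_aborted, not_not.2 (isUBatched_of_opt_mem hH hU hb h.opt_mem)⟩

theorem goodState_zero :
    I.GoodState γ μ jopt 0 (I.state γ x 0) := by
  refine ⟨?_, ?_, ?_, ?_, ?_, ?_⟩ <;> simp [state, gridPoint_zero]

/-- One batch. An optimal arm survives since the two empirical means that are compared are each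
off by less than half of the threshold, and for the same reason the arms that survive have a gap
of less than twice the threshold. -/
theorem GoodState.succ (hK : 1 ≤ K) (hH : 1 < I.horizon)
    (hU : ∀ j, I.U ≤ (Finset.univ.filter (fun i => jopt i = j)).card)
    (hμ : ∀ i j, μ i j ≤ μ i (jopt i)) (hγ : 0 ≤ γ)
    (hdec : ∀ b < I.batches, ∀ A, IsUBatched I.U (I.batchSize b) A →
      (I.decompose (I.batchSize b) A).IsDecomposition I.C (batchedWeight (I.batchSize b) A))
    (hx : x ∉ I.badEvent γ μ n) (hn : I.horizon + I.batches ≤ n) (hb : b < I.batches)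
    (h : I.GoodState γ μ jopt b (I.state γ x b)) :
    I.GoodState γ μ jopt (b + 1) (I.state γ x (b + 1)) := by
  have hKR : (0 : ℝ) < K := by exact_mod_cast hK
  have hnst := h.not_stops hH hU hb
  have hst := state_succ_of_not_stops I hnst
  rw [afterBatch_eq] at hst
  have hbat := isUBatched_of_opt_mem hH hU hb h.opt_mem
  have hcard := I.card_sampled (hdec b hb _ hbat)
  set s := I.state γ x b with hs
  have hcount : ∀ i, ∀ j ∈ s.active i, I.nextCount b s i j =
      s.count i (jopt i) + ⌈I.batchSize b / (s.active i).card⌉₊ := by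
    intro i j hj
    have hw : batchedWeight (I.batchSize b) s.active i j = I.batchSize b / (s.active i).card := by
      simp [batchedWeight, hj]
    rw [← hw, ← hcard i j, ← h.count_eq i j hj]
    rfl
  have hgrid : gridPoint I.horizon I.batches (b + 1) =
      gridPoint I.horizon I.batches b + I.batchSize b := by
    unfold batchSize; ring
  have hsub : ∀ i, ∀ j ∈ (I.state γ x (b + 1)).active i, j ∈ s.active i := by
    intro i j hj
    rw [hst] at hj
    exact Finset.mem_of_mem_filter j hj
  have hcount' : ∀ i, ∀ j ∈ s.active i, (I.state γ x (b + 1)).count i j =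
      s.count i (jopt i) + ⌈I.batchSize b / (s.active i).card⌉₊ := by
    intro i j hj; rw [hst]; exact hcount i j hj
  have hle : ∀ i, gridPoint I.horizon I.batches (b + 1) / K ≤
      (I.state γ x (b + 1)).count i (jopt i) := by
    intro i
    rw [hcount' i _ (h.opt_mem i), hgrid, add_div]
    push_cast
    refine add_le_add (h.le_count i) ((div_le_div_of_nonneg_left hbat.pos.le ?_ ?_).trans
      (Nat.le_ceil _))
    · exact_mod_cast Finset.card_pos.2 (hbat.nonempty i)
    · exact_mod_cast (by simpa using Finset.card_le_univ (s.active i) : (s.active i).card ≤ K)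
  have hge : ∀ i, ((I.state γ x (b + 1)).count i (jopt i) : ℝ) ≤
      gridPoint I.horizon I.batches (b + 1) + (b + 1 : ℕ) := by
    intro i
    rw [hcount' i _ (h.opt_mem i), hgrid]
    push_cast
    have h1 : (⌈I.batchSize b / (s.active i).card⌉₊ : ℝ) ≤ I.batchSize b + 1 := by
      refine (Nat.ceil_lt_add_one (div_nonneg hbat.pos.le (by positivity))).le.trans ?_
      gcongr
      refine div_le_self hbat.pos.le ?_
      exact_mod_cast Finset.card_pos.2 (hbat.nonempty i)
    have h2 := h.count_le i
    linarith
  have hpos : 0 < gridPoint I.horizon I.batches (b + 1) := gridPoint_pos hH (by omega)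
  -- The accuracy of the empirical means.
  have hacc : ∀ i, ∀ j ∈ s.active i,
      |I.nextSum x b s i j / I.nextCount b s i j - μ i j| <
        √(γ / (I.state γ x (b + 1)).count i (jopt i)) / 2 := by
    intro i j hj
    have heq : (I.state γ x (b + 1)).count i j = (I.state γ x (b + 1)).count i (jopt i) := by
      rw [hcount' i j hj, hcount' i _ (h.opt_mem i)]
    have h1 : 1 ≤ (I.state γ x (b + 1)).count i j := by
      have : (0 : ℝ) < (I.state γ x (b + 1)).count i (jopt i) :=
        lt_of_lt_of_le (div_pos hpos hKR) (hle i)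
      rw [heq]
      exact_mod_cast this
    have h2 : (I.state γ x (b + 1)).count i j ≤ n := by
      have h3 : ((I.state γ x (b + 1)).count i (jopt i) : ℝ) ≤ n := by
        refine (hge i).trans (le_trans ?_ hn)
        refine add_le_add (gridPoint_le hH.le) ?_
        exact_mod_cast hb
      rw [heq]
      exact_mod_cast h3
    have h3 := I.abs_sub_lt_of_notMem_badEvent hx (b := b + 1) hb i j h1 h2
    rw [heq] at h3
    rw [hst] at h3 ⊢
    have heq' : I.nextCount b s i j = I.nextCount b s i (jopt i) := by
      rw [hcount i j hj, hcount i _ (h.opt_mem i)]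
    simp only at h3 ⊢
    rw [heq']
    exact h3
  have hsup : ∀ i, (s.active i).sup (I.nextCount b s i) =
      (I.state γ x (b + 1)).count i (jopt i) := by
    intro i
    rw [hcount' i _ (h.opt_mem i)]
    refine le_antisymm (Finset.sup_le fun j hj => (hcount i j hj).le) ?_
    rw [← hcount i _ (h.opt_mem i)]
    exact Finset.le_sup (h.opt_mem i)
  have hmem : ∀ i j, j ∈ (I.state γ x (b + 1)).active i ↔ j ∈ s.active i ∧ ∀ j' ∈ s.active i,
      I.nextSum x b s i j' / I.nextCount b s i j' - I.nextSum x b s i j / I.nextCount b s i j <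
        √(γ / (I.state γ x (b + 1)).count i (jopt i)) := by
    intro i j
    rw [← hsup i, hst]
    exact Finset.mem_filter
  refine ⟨by rw [hst]; exact not_false, ?_, ?_, hle, hge, ?_⟩
  · intro i
    refine (hmem i _).2 ⟨h.opt_mem i, fun j' hj' => ?_⟩
    have h1 := abs_lt.1 (hacc i j' hj')
    have h2 := abs_lt.1 (hacc i _ (h.opt_mem i))
    have h3 := hμ i j'
    linarith [h1.1, h1.2, h2.1, h2.2]
  · intro i j hj
    rw [hcount' i j (hsub i j hj), hcount' i _ (h.opt_mem i)]
  · intro _ i j hj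
    obtain ⟨hj1, hj2⟩ := (hmem i j).1 hj
    have h0 := hj2 _ (h.opt_mem i)
    have h1 := abs_lt.1 (hacc i j hj1)
    have h2 := abs_lt.1 (hacc i _ (h.opt_mem i))
    have h3 : √(γ / (I.state γ x (b + 1)).count i (jopt i)) ≤
        √(γ * K / gridPoint I.horizon I.batches (b + 1)) := by
      refine Real.sqrt_le_sqrt ?_
      calc γ / (I.state γ x (b + 1)).count i (jopt i)
          ≤ γ / (gridPoint I.horizon I.batches (b + 1) / K) :=
            div_le_div_of_nonneg_left hγ (div_pos hpos hKR) (hle i)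
        _ = γ * K / gridPoint I.horizon I.batches (b + 1) := by field_simp
    linarith [h1.1, h1.2, h2.1, h2.2]

theorem goodState (hK : 1 ≤ K) (hH : 1 < I.horizon)
    (hU : ∀ j, I.U ≤ (Finset.univ.filter (fun i => jopt i = j)).card)
    (hμ : ∀ i j, μ i j ≤ μ i (jopt i)) (hγ : 0 ≤ γ)
    (hdec : ∀ b < I.batches, ∀ A, IsUBatched I.U (I.batchSize b) A →
      (I.decompose (I.batchSize b) A).IsDecomposition I.C (batchedWeight (I.batchSize b) A))
    (hx : x ∉ I.badEvent γ μ n) (hn : I.horizon + I.batches ≤ n) (hb : b ≤ I.batches) :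
    I.GoodState γ μ jopt b (I.state γ x b) := by
  induction b with
  | zero => exact goodState_zero
  | succ b ih => exact (ih (by omega)).succ hK hH hU hμ hγ hdec hx hn hb

/-- In the rounds of a batch that is not aborted, everybody plays an active arm, since the
assignments of a decomposition use only arms that are in demand. -/
theorem arm_mem_active_of_lt {t : ℕ} (hb : I.currentBatch γ x t < I.batches)
    (hst : ¬ I.stops (I.currentBatch γ x t) (I.state γ x (I.currentBatch γ x t)))
    (hD : (I.decomposition (I.currentBatch γ x t)
      (I.state γ x (I.currentBatch γ x t))).IsDecomposition I.C
      (batchedWeight (I.batchSize (I.currentBatch γ x t))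
        (I.state γ x (I.currentBatch γ x t)).active)) (i : Fin N) :
    (I.strategy γ x t).arm i ∈ (I.state γ x (I.currentBatch γ x t)).active i := by
  have h1 := I.start_currentBatch_le γ x t
  have h2 := I.lt_start_currentBatch_succ hb
  rw [start_succ, if_neg hst] at h2
  have hr : (t - (I.state γ x (I.currentBatch γ x t)).start) / (2 * I.C + 2) <
      (I.decomposition (I.currentBatch γ x t) (I.state γ x (I.currentBatch γ x t))).len :=
    Nat.div_lt_of_lt_mul (by omega)
  have hw := hD.demanded _ hr i
  unfold strategy
  simp only [hb, if_true]
  by_contra hne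
  exact hw (by simp only [batchedWeight, hne, if_false])

end Input

/-! ### The regret -/

theorem pseudoRegret_le_of_mem_Icc {μ : Fin N → Fin K → ℝ} (hμ : ∀ i j, μ i j ∈ Set.Icc (0 : ℝ) 1)
    (S : Strategy N K) (T : ℕ) (x : RewardTable N K) : pseudoRegret μ S T x ≤ N * T := by
  have h : ∀ t ∈ Finset.range T,
      ∑ i, ((⨆ j, μ i j) - μ i ((S x t).arm i)) ≤ N := by
    intro t _
    refine (Finset.sum_le_card_nsmul _ _ 1 fun i _ => ?_).trans_eq (by simp)
    have : Nonempty (Fin K) := ⟨(S x t).arm i⟩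
    have h1 : (⨆ j, μ i j) ≤ 1 := ciSup_le fun j => (hμ i j).2
    linarith [(hμ i ((S x t).arm i)).1]
  refine (Finset.sum_le_card_nsmul _ _ _ h).trans_eq ?_
  simp [mul_comm]

namespace Input

variable {I : Input N K} {γ c : ℝ} {μ : Fin N → Fin K → ℝ} {jopt : Fin N → Fin K} {b n : ℕ}
  {x : RewardTable N K}

/-- The bound `1 + 2 √(γ K)` times `t_b ^ (- 1 / 2)` on the gaps in the batch with index `b`,
where `t_0` is replaced by `1`. -/
noncomputable def gapBound (I : Input N K) (γ : ℝ) (b : ℕ) : ℝ :=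
  (1 + 2 * √(γ * K)) * I.horizon ^ (-(1 - 1 / (2 : ℝ) ^ b) / 2)

theorem GoodState.gap_le_min (hH : 1 < I.horizon) (hμ : ∀ i j, μ i j ≤ μ i (jopt i))
    (hmem : ∀ i j, μ i j ∈ Set.Icc (0 : ℝ) 1) (hb : b < I.batches) {s : State N K}
    (h : I.GoodState γ μ jopt b s) {i : Fin N} {j : Fin K} (hj : j ∈ s.active i) :
    (⨆ j, μ i j) - μ i j ≤ min 1 (I.gapBound γ b) := by
  have : Nonempty (Fin K) := ⟨j⟩
  have hsup : (⨆ j, μ i j) ≤ μ i (jopt i) := ciSup_le (hμ i)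
  have hone : μ i (jopt i) - μ i j ≤ 1 := by linarith [(hmem i (jopt i)).2, (hmem i j).1]
  have hH0 : 0 < I.horizon := by linarith
  refine le_min (by linarith) ?_
  have hs : 0 ≤ √(γ * K) := Real.sqrt_nonneg _
  rcases Nat.eq_zero_or_pos b with rfl | hb0
  · simp only [gapBound, pow_zero, div_one, sub_self, neg_zero, zero_div, Real.rpow_zero, mul_one]
    linarith
  · have h1 := h.gap_le hb0 i j hj
    rw [gridPoint_of_lt hb0 hb, Real.sqrt_div' _ (by positivity),
      Real.sqrt_eq_rpow (I.horizon ^ _), ← Real.rpow_mul hH0.le, div_eq_mul_inv,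
      ← Real.rpow_neg hH0.le] at h1
    have h2 : -((1 - 1 / (2 : ℝ) ^ b) * (1 / 2)) = -(1 - 1 / (2 : ℝ) ^ b) / 2 := by ring
    rw [h2] at h1
    have h3 : 0 < I.horizon ^ (-(1 - 1 / (2 : ℝ) ^ b) / 2) := Real.rpow_pos_of_pos hH0 _
    unfold gapBound
    nlinarith

/-- The index of the batch whose active arms are played in round `t`: in the rounds that are left
after the last batch, these are still the active arms of the last batch. -/
noncomputable def playedBatch (I : Input N K) (γ : ℝ) (x : RewardTable N K) (t : ℕ) : ℕ :=
  min (I.currentBatch γ x t) (I.batches - 1)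

theorem card_playedBatch_le (T : ℕ) (hb : b < I.batches - 1) :
    ((Finset.range T).filter (fun t => I.playedBatch γ x t = b)).card ≤
      (I.state γ x (b + 1)).start - (I.state γ x b).start := by
  have : (Finset.range T).filter (fun t => I.playedBatch γ x t = b) ⊆
      Finset.Ico (I.state γ x b).start (I.state γ x (b + 1)).start := by
    intro t ht
    have h1 : I.currentBatch γ x t = b := by
      have := (Finset.mem_filter.1 ht).2
      unfold playedBatch at this
      omega
    have h2 := I.start_currentBatch_le γ x t
    have h3 := I.lt_start_currentBatch_succ (γ := γ) (x := x) (t := t) (by omega)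
    rw [h1] at h2 h3
    exact Finset.mem_Ico.2 ⟨h2, h3⟩
  simpa using Finset.card_le_card this

/-- The bound on the number of rounds of a batch times its gap. Demand `t_{b + 1}` and gap
`t_b ^ (- 1 / 2)` balance: their product is `√T'` for every inner point of the grid. -/
theorem demand_mul_gapBound_le (hH : 1 < I.horizon) (hb : b + 1 < I.batches) :
    I.batchSize b * I.gapBound γ b ≤ (1 + 2 * √(γ * K)) * √I.horizon := by
  have hH0 : 0 < I.horizon := by linarith
  have h0 : 0 ≤ gridPoint I.horizon I.batches b := by
    rcases Nat.eq_zero_or_pos b with rfl | h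
    · rw [gridPoint_zero]
    · exact (gridPoint_pos hH h).le
  have h1 : I.batchSize b ≤ I.horizon ^ (1 - 1 / (2 : ℝ) ^ (b + 1)) := by
    unfold batchSize
    rw [gridPoint_of_lt (by omega) hb]
    linarith
  have h2 : 0 ≤ I.gapBound γ b := by unfold gapBound; positivity
  refine (mul_le_mul_of_nonneg_right h1 h2).trans_eq ?_
  unfold gapBound
  rw [mul_left_comm, ← Real.rpow_add hH0, Real.sqrt_eq_rpow I.horizon]
  congr 2
  rw [pow_succ]
  field_simp
  ring

/-- The last batch is long, but `T' ^ (2 ^ (- B)) ≤ 2` since `B ≥ log log T`. -/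
theorem gapBound_last_le (hH : 1 < I.horizon) (hHT : I.horizon ≤ I.T) (hT : 1 < Real.logb 2 I.T) :
    I.gapBound γ (I.batches - 1) ≤ 2 * (1 + 2 * √(γ * K)) / √I.horizon := by
  have hH0 : 0 < I.horizon := by linarith
  have hT0 : (0 : ℝ) < I.T := by linarith
  have hB : 1 ≤ I.batches := le_max_left _ _
  have hlog : Real.logb 2 I.T ≤ 2 ^ I.batches := by
    have h1 : Real.logb 2 (Real.logb 2 I.T) ≤ I.batches :=
      (Nat.le_ceil _).trans (Nat.cast_le.2 (le_max_right _ _))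
    rw [Real.logb_le_iff_le_rpow (by norm_num) (by linarith)] at h1
    simpa using h1
  have h2 : I.horizon ^ (1 / (2 : ℝ) ^ I.batches) ≤ 2 := by
    calc I.horizon ^ (1 / (2 : ℝ) ^ I.batches)
        ≤ (I.T : ℝ) ^ (1 / (2 : ℝ) ^ I.batches) :=
          Real.rpow_le_rpow hH0.le hHT (by positivity)
      _ ≤ (I.T : ℝ) ^ (1 / Real.logb 2 I.T) := by
          refine Real.rpow_le_rpow_of_exponent_le (by linarith) ?_
          exact one_div_le_one_div_of_le (by linarith) hlog
      _ = 2 := by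
          conv_lhs => rw [← Real.rpow_logb (b := 2) (by norm_num) (by norm_num) hT0]
          rw [← Real.rpow_mul (by norm_num), Real.rpow_logb (by norm_num) (by norm_num) hT0,
            mul_one_div_cancel (by linarith), Real.rpow_one]
  have h3 : I.gapBound γ (I.batches - 1) =
      (1 + 2 * √(γ * K)) * (I.horizon ^ (1 / (2 : ℝ) ^ I.batches) / √I.horizon) := by
    unfold gapBound
    rw [Real.sqrt_eq_rpow I.horizon, ← Real.rpow_sub hH0]
    congr 2
    obtain ⟨k, hk⟩ : ∃ k, I.batches = k + 1 := ⟨I.batches - 1, by omega⟩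
    rw [hk, Nat.add_sub_cancel, pow_succ]
    field_simp
    ring
  rw [h3, ← mul_div_assoc, mul_comm 2 (1 + _)]
  refine div_le_div_of_nonneg_right (mul_le_mul_of_nonneg_left h2 ?_) (Real.sqrt_nonneg _)
  positivity

theorem pseudoRegret_le_of_notMem_badEvent (hK : 1 ≤ K) (hα : 1 ≤ I.α) (hH : 1 < I.horizon)
    (hHT : I.horizon ≤ I.T) (hT : 1 < Real.logb 2 I.T) (hc : 0 ≤ c)
    (hdec : IsDecomposer I.C I.U I.α c I.decompose)
    (hU : ∀ j, I.U ≤ (Finset.univ.filter (fun i => jopt i = j)).card)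
    (hμ : ∀ i j, μ i j ≤ μ i (jopt i)) (hmem : ∀ i j, μ i j ∈ Set.Icc (0 : ℝ) 1)
    (hγ : 0 ≤ γ) (hx : x ∉ I.badEvent γ μ n) (hn : I.horizon + I.batches ≤ n) :
    pseudoRegret μ (I.strategy γ) I.T x ≤
      N * (I.batches * (2 * (1 + 2 * √(γ * K)) * √(I.α * (2 * I.C + 2) * I.T) +
        (2 * I.C + 2) * (c * N * K))) := by
  have hB : 1 ≤ I.batches := le_max_left _ _
  have hH0 : 0 < I.horizon := by linarith
  have ha : (0 : ℝ) < I.α * (2 * I.C + 2) := by positivity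
  have hgood : ∀ b ≤ I.batches, I.GoodState γ μ jopt b (I.state γ x b) := fun b hb =>
    goodState hK hH hU hμ hγ (fun b _ A hA => (hdec _ A hA).1) hx hn hb
  have hgap : ∀ t i, (⨆ j, μ i j) - μ i ((I.strategy γ x t).arm i) ≤
      min 1 (I.gapBound γ (I.playedBatch γ x t)) := by
    intro t i
    refine (hgood _ ((min_le_right _ _).trans (Nat.sub_le _ _))).gap_le_min hH hμ hmem
      (lt_of_le_of_lt (min_le_right _ _) (by omega)) ?_
    rcases lt_or_ge (I.currentBatch γ x t) I.batches with hlt | hge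
    · rw [min_eq_left (by omega)]
      have hg := hgood _ hlt.le
      exact arm_mem_active_of_lt hlt (hg.not_stops hH hU hlt)
        (hdec _ _ (isUBatched_of_opt_mem hH hU hlt hg.opt_mem)).1 i
    · rw [min_eq_right (by omega)]
      unfold strategy
      simp only [not_lt.2 hge, if_false]
      exact I.filler_mem _ ⟨_, (hgood _ (Nat.sub_le _ _)).opt_mem i⟩
  set X := 2 * (1 + 2 * √(γ * K)) * √(I.α * (2 * I.C + 2) * I.T) +
    (2 * I.C + 2) * (c * N * K) with hX
  have hsqrt1 : I.α * (2 * I.C + 2) * √I.horizon = √(I.α * (2 * I.C + 2) * I.T) := by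
    symm
    rw [Real.sqrt_eq_iff_mul_self_eq (by positivity) (by positivity)]
    have := Real.mul_self_sqrt hH0.le
    calc I.α * (2 * I.C + 2) * I.T = (I.α * (2 * I.C + 2)) ^ 2 * I.horizon := by
          rw [horizon]; field_simp
      _ = (I.α * (2 * I.C + 2)) ^ 2 * (√I.horizon * √I.horizon) := by rw [this]
      _ = _ := by ring
  have hsqrt2 : I.T / √I.horizon = √(I.α * (2 * I.C + 2) * I.T) := by
    rw [← hsqrt1, div_eq_iff (Real.sqrt_pos.2 hH0).ne', mul_assoc, Real.mul_self_sqrt hH0.le,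
      horizon]
    field_simp
  have hnonneg : 0 ≤ (2 * (I.C : ℝ) + 2) * (c * N * K) := by positivity
  have hbatch : ∀ b ∈ Finset.range I.batches,
      (((Finset.range I.T).filter (fun t => I.playedBatch γ x t = b)).card : ℝ) *
        min 1 (I.gapBound γ b) ≤ X := by
    intro b hb
    rw [Finset.mem_range] at hb
    have hg0 : 0 ≤ I.gapBound γ b := by unfold gapBound; positivity
    rcases Nat.lt_or_ge b (I.batches - 1) with hlt | hge
    · have hg := hgood b hb.le
      have hns := hg.not_stops hH hU hb
      have hcard := card_playedBatch_le (γ := γ) (x := x) I.T hlt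
      rw [start_succ, if_neg hns, Nat.add_sub_cancel_left] at hcard
      have hlen := (hdec _ _ (isUBatched_of_opt_mem hH hU hb hg.opt_mem)).2
      have hcardR : (((Finset.range I.T).filter (fun t => I.playedBatch γ x t = b)).card : ℝ) ≤
          (2 * I.C + 2) * (I.α * I.batchSize b + c * N * K) := by
        refine (Nat.cast_le.2 hcard).trans ?_
        push_cast
        exact mul_le_mul_of_nonneg_left hlen (by positivity)
      have h1 := demand_mul_gapBound_le (I := I) (γ := γ) hH (b := b) (by omega)
      calc _ ≤ (2 * I.C + 2) * (I.α * I.batchSize b + c * N * K) * min 1 (I.gapBound γ b) :=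
            mul_le_mul_of_nonneg_right hcardR (le_min zero_le_one hg0)
        _ = I.α * (2 * I.C + 2) * (I.batchSize b * min 1 (I.gapBound γ b)) +
            (2 * I.C + 2) * (c * N * K) * min 1 (I.gapBound γ b) := by ring
        _ ≤ I.α * (2 * I.C + 2) * ((1 + 2 * √(γ * K)) * √I.horizon) +
            (2 * I.C + 2) * (c * N * K) * 1 := by
          refine add_le_add (mul_le_mul_of_nonneg_left (le_trans ?_ h1) ha.le)
            (mul_le_mul_of_nonneg_left (min_le_left _ _) hnonneg)
          exact mul_le_mul_of_nonneg_left (min_le_right _ _)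
            (sub_pos.2 (gridPoint_lt_succ hH hb)).le
        _ = (1 + 2 * √(γ * K)) * √(I.α * (2 * I.C + 2) * I.T) +
            (2 * I.C + 2) * (c * N * K) := by rw [← hsqrt1]; ring
        _ ≤ X := by
          have : 0 ≤ (1 + 2 * √(γ * K)) * √(I.α * (2 * I.C + 2) * I.T) := by positivity
          rw [hX]
          linarith
    · have hbl : b = I.batches - 1 := by omega
      have hcardR : (((Finset.range I.T).filter (fun t => I.playedBatch γ x t = b)).card : ℝ) ≤
          I.T := by
        exact_mod_cast (Finset.card_filter_le _ _).trans (Finset.card_range _).le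
      calc _ ≤ (I.T : ℝ) * I.gapBound γ b :=
            mul_le_mul hcardR (min_le_right _ _) (le_min zero_le_one hg0) (by positivity)
        _ ≤ I.T * (2 * (1 + 2 * √(γ * K)) / √I.horizon) := by
            rw [hbl]
            exact mul_le_mul_of_nonneg_left (gapBound_last_le hH hHT hT) (by positivity)
        _ = 2 * (1 + 2 * √(γ * K)) * √(I.α * (2 * I.C + 2) * I.T) := by
            rw [← hsqrt2]; ring
        _ ≤ X := by rw [hX]; linarith
  calc pseudoRegret μ (I.strategy γ) I.T x
      ≤ ∑ t ∈ Finset.range I.T, N * min 1 (I.gapBound γ (I.playedBatch γ x t)) := by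
        refine Finset.sum_le_sum fun t _ => ?_
        refine (Finset.sum_le_card_nsmul _ _ _ fun i _ => hgap t i).trans_eq ?_
        simp
    _ = N * ∑ b ∈ Finset.range I.batches,
        (((Finset.range I.T).filter (fun t => I.playedBatch γ x t = b)).card : ℝ) *
          min 1 (I.gapBound γ b) := by
        rw [← Finset.mul_sum]
        congr 1
        rw [← Finset.sum_fiberwise_of_maps_to (g := I.playedBatch γ x) (t := Finset.range I.batches)
          fun t _ => Finset.mem_range.2 (lt_of_le_of_lt (min_le_right _ _) (by omega))]
        refine Finset.sum_congr rfl fun b _ => ?_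
        rw [Finset.sum_congr rfl (g := fun _ => min 1 (I.gapBound γ b))
          fun t ht => by rw [(Finset.mem_filter.1 ht).2]]
        simp
    _ ≤ N * (I.batches * X) := by
        refine mul_le_mul_of_nonneg_left ?_ (by positivity)
        refine (Finset.sum_le_card_nsmul _ _ _ hbatch).trans_eq ?_
        simp

end Input

namespace Input

variable {I : Input N K}

theorem batches_le (hT : 1 ≤ I.T) : (I.batches : ℝ) ≤ 4 * Real.log I.T + 1 := by
  have hlogT : 0 ≤ Real.log I.T := Real.log_nonneg (by exact_mod_cast hT)
  have hlog2 : 1 / 2 ≤ Real.log 2 := by linarith [Real.log_two_gt_d9]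
  have key : ∀ z : ℝ, 0 ≤ z → z / Real.log 2 ≤ 2 * z := by
    intro z hz
    rw [div_le_iff₀ (by linarith)]
    nlinarith
  have h1 : Real.logb 2 I.T ≤ 2 * Real.log I.T := key _ hlogT
  have h0 : 0 ≤ Real.logb 2 I.T := div_nonneg hlogT (by linarith)
  have h2 : Real.logb 2 (Real.logb 2 I.T) ≤ 2 * Real.logb 2 I.T :=
    (div_le_div_of_nonneg_right (Real.log_le_self h0) (by linarith)).trans (key _ h0)
  unfold batches
  rw [Nat.cast_max, Nat.cast_one]
  refine max_le (by linarith) ?_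
  rcases le_or_gt (Real.logb 2 (Real.logb 2 I.T)) 0 with h | h
  · rw [Nat.ceil_eq_zero.2 h]
    push_cast
    linarith
  · linarith [Nat.ceil_lt_add_one h.le]

section Law

variable {ν : Fin N → Fin K → Measure ℝ} [∀ i j, IsProbabilityMeasure (ν i j)]

theorem regret_le_of_pseudoRegret_le (hν : IsInstance ν) (γ : ℝ) {R : ℝ} (hR : 0 ≤ R)
    {E : Set (RewardTable N K)} (hE : MeasurableSet E)
    (h : ∀ x, x ∉ E → pseudoRegret (meanReward ν) (I.strategy γ) I.T x ≤ R) :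
    regret ν (I.strategy γ) I.T ≤ R + N * I.T * (rewardLaw ν).real E := by
  have hpt : ∀ x, pseudoRegret (meanReward ν) (I.strategy γ) I.T x ≤
      R + E.indicator (fun _ => (N * I.T : ℝ)) x := by
    intro x
    by_cases hx : x ∈ E
    · rw [Set.indicator_of_mem hx]
      linarith [pseudoRegret_le_of_mem_Icc hν.mean_mem (I.strategy γ) I.T x]
    · rw [Set.indicator_of_notMem hx, add_zero]
      exact h x hx
  have hint : Integrable (E.indicator (fun _ => (N * I.T : ℝ))) (rewardLaw ν) :=
    (integrable_const _).indicator hE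
  rw [regret_eq_integral_pseudoRegret hν (I.measurable_arm γ) (I.dependsOnRounds_arm γ)]
  refine (integral_mono (integrable_pseudoRegret ν (I.measurable_arm γ) I.T)
    ((integrable_const R).add hint) hpt).trans_eq ?_
  simp only [Pi.add_apply]
  rw [integral_add (integrable_const R) hint, integral_indicator_const _ hE]
  simp [mul_comm]

/-- The bound on the regret if the horizon `T'` of the copies of batched successive elimination is
at most `1`; then `T` is so small that the trivial bound suffices. -/
theorem regret_le_of_horizon_le_one (hν : IsInstance ν) (γ : ℝ) (hK : 1 ≤ K) (hC : 1 ≤ I.C)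
    (hα : 1 ≤ I.α) (hH : I.horizon ≤ 1) :
    regret ν (I.strategy γ) I.T ≤ 2 * (N * I.C * √(I.α * K * I.T)) := by
  have hCR : (1 : ℝ) ≤ I.C := by exact_mod_cast hC
  have hKR : (1 : ℝ) ≤ K := by exact_mod_cast hK
  have h := regret_le_of_pseudoRegret_le (I := I) hν γ (R := N * I.T) (by positivity)
    MeasurableSet.empty fun x _ => pseudoRegret_le_of_mem_Icc hν.mean_mem _ _ x
  rw [measureReal_empty, mul_zero, add_zero] at h
  refine h.trans ?_
  have hT : (I.T : ℝ) ≤ I.α * (2 * I.C + 2) := by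
    rw [horizon, div_le_one (by positivity)] at hH
    exact hH
  have h1 : (I.T : ℝ) ≤ 2 * I.C * √(I.α * K * I.T) := by
    have h2 : (I.T : ℝ) ≤ √((2 * I.C) ^ 2 * (I.α * K * I.T)) := by
      refine Real.le_sqrt_of_sq_le ?_
      have h3 : I.α * (2 * I.C + 2) ≤ (2 * I.C) ^ 2 * (I.α * K) := by
        have : 2 * (I.C : ℝ) + 2 ≤ (2 * I.C) ^ 2 * K := by nlinarith [sq_nonneg (I.C : ℝ)]
        nlinarith
      calc (I.T : ℝ) ^ 2 = I.T * I.T := by ring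
        _ ≤ ((2 * I.C) ^ 2 * (I.α * K)) * I.T :=
          mul_le_mul_of_nonneg_right (hT.trans h3) (by positivity)
        _ = _ := by ring
    rwa [Real.sqrt_mul (by positivity), Real.sqrt_sq (by positivity)] at h2
  calc (N : ℝ) * I.T ≤ N * (2 * I.C * √(I.α * K * I.T)) := by gcongr
    _ = _ := by ring

/-- The expected contribution of the bad event to the regret is bounded by a constant. For `g ≥ 120`
a single deviation has probability at most `2 (N K T) ^ (-3)`, and the number of samples is at
most `6 T` since `T' ≤ T` and `B ≤ 5 T`. -/
theorem measure_badEvent_mul_le (hν : IsInstance ν) (hN : 1 ≤ N) (hK : 1 ≤ K) (hC : 1 ≤ I.C)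
    (hT : 1 ≤ I.T) {g : ℝ} (hg : 120 ≤ g) :
    N * I.T * (rewardLaw ν).real
      (I.badEvent (g * I.C * Real.log (N * K * I.T)) (meanReward ν) (6 * I.T)) ≤ 72 := by
  have hCR : (1 : ℝ) ≤ I.C := by exact_mod_cast hC
  have hKR : (1 : ℝ) ≤ K := by exact_mod_cast hK
  have hNR : (1 : ℝ) ≤ N := by exact_mod_cast hN
  have hTR : (1 : ℝ) ≤ I.T := by exact_mod_cast hT
  have hNKT : (1 : ℝ) ≤ N * K * I.T :=
    one_le_mul_of_one_le_of_one_le (one_le_mul_of_one_le_of_one_le hNR hKR) hTR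
  set ℓ := Real.log (N * K * I.T) with hℓ
  have hℓ0 : 0 ≤ ℓ := Real.log_nonneg hNKT
  have hexp : Real.exp (-(g * I.C * ℓ / (8 * (4 * I.C + 1)))) ≤ ((N * K * I.T : ℝ) ^ 3)⁻¹ := by
    have h1 : 3 * ℓ ≤ g * I.C * ℓ / (8 * (4 * I.C + 1)) := by
      rw [le_div_iff₀ (by positivity)]
      have h2 : 3 * (8 * (4 * (I.C : ℝ) + 1)) ≤ g * I.C := by nlinarith
      nlinarith
    refine (Real.exp_le_exp.2 (neg_le_neg h1)).trans_eq ?_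
    rw [Real.exp_neg, show 3 * ℓ = (3 : ℕ) * ℓ by norm_num, Real.exp_nat_mul, hℓ,
      Real.exp_log (by linarith)]
  have hbad := I.measure_badEvent_le hν (γ := g * I.C * ℓ) (by positivity) (6 * I.T)
  have hB : (I.batches : ℝ) + 1 ≤ 6 * I.T := by
    have h1 := batches_le hT
    have h2 : Real.log I.T ≤ I.T - 1 := Real.log_le_sub_one_of_pos (by linarith)
    linarith
  have h1 : (rewardLaw ν).real (I.badEvent (g * I.C * ℓ) (meanReward ν) (6 * I.T)) ≤
      (6 * I.T) * N * K * (6 * I.T) * (2 * ((N * K * I.T : ℝ) ^ 3)⁻¹) := by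
    refine hbad.trans ?_
    push_cast
    gcongr
  calc _ ≤ N * I.T * ((6 * I.T) * N * K * (6 * I.T) * (2 * ((N * K * I.T : ℝ) ^ 3)⁻¹)) :=
        mul_le_mul_of_nonneg_left h1 (by positivity)
    _ = 72 / (N * K ^ 2) := by field_simp; ring
    _ ≤ 72 := div_le_self (by norm_num)
        (one_le_mul_of_one_le_of_one_le hNR (one_le_pow₀ hKR))

theorem regret_le (hν : IsInstance ν) (hN : 1 ≤ N) (hK : 1 ≤ K) (hC : 1 ≤ I.C) (hT : 1 ≤ I.T)
    (hα : 1 ≤ I.α) {c : ℝ} (hc : 0 ≤ c) (hdec : IsDecomposer I.C I.U I.α c I.decompose)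
    (hcNK : c * N * K ≤ √(I.α * K * I.T)) (hU : UserCluster I.U (meanReward ν)) {g : ℝ}
    (hg : 120 ≤ g) :
    regret ν (I.strategy (g * I.C * Real.log (N * K * I.T))) I.T ≤
      (32 * (1 + 2 * √g) + 72) * (1 + Real.log (N * K * I.C * I.T)) ^ 2 *
        (N * I.C * √(I.α * K * I.T)) := by
  obtain ⟨jopt, hμ, hU⟩ := hU
  have hCR : (1 : ℝ) ≤ I.C := by exact_mod_cast hC
  have hKR : (1 : ℝ) ≤ K := by exact_mod_cast hK
  have hNR : (1 : ℝ) ≤ N := by exact_mod_cast hN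
  have hTR : (1 : ℝ) ≤ I.T := by exact_mod_cast hT
  have hNK : (1 : ℝ) ≤ N * K := one_le_mul_of_one_le_of_one_le hNR hKR
  have hNKT : (1 : ℝ) ≤ N * K * I.T := one_le_mul_of_one_le_of_one_le hNK hTR
  set ℓ := Real.log (N * K * I.T) with hℓ
  set Λ := 1 + Real.log (N * K * I.C * I.T) with hΛ
  set Q := √(I.α * K * I.T) with hQ
  have hℓ0 : 0 ≤ ℓ := Real.log_nonneg hNKT
  have hℓΛ : 1 + ℓ ≤ Λ := by
    refine add_le_add_right (Real.log_le_log (by linarith) ?_) 1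
    nlinarith
  have hΛ1 : 1 ≤ Λ := by linarith
  have hlogT : Real.log I.T ≤ ℓ :=
    Real.log_le_log (by linarith) (le_mul_of_one_le_left (by linarith) hNK)
  have hQ1 : 1 ≤ Q := by
    refine Real.one_le_sqrt.2 ?_
    exact one_le_mul_of_one_le_of_one_le (one_le_mul_of_one_le_of_one_le hα hKR) hTR
  have hNCQ : 1 ≤ N * I.C * Q :=
    one_le_mul_of_one_le_of_one_le (one_le_mul_of_one_le_of_one_le hNR hCR) hQ1
  have hΛ2 : 1 ≤ Λ ^ 2 := one_le_pow₀ hΛ1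
  have hg0 : 0 ≤ √g := Real.sqrt_nonneg g
  rcases le_or_gt I.horizon 1 with hH | hH
  · refine (regret_le_of_horizon_le_one hν _ hK hC hα hH).trans ?_
    refine mul_le_mul_of_nonneg_right ?_ (by linarith)
    nlinarith
  have ha4 : 4 ≤ I.α * (2 * I.C + 2) := by nlinarith
  have hHT : I.horizon ≤ I.T := div_le_self (by linarith) (by linarith)
  have hT4 : (4 : ℝ) < I.T := by
    rw [horizon, one_lt_div (by linarith)] at hH
    linarith
  have hlogb : 1 < Real.logb 2 I.T := by
    rw [Real.lt_logb_iff_rpow_lt (by norm_num) (by linarith), Real.rpow_one]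
    linarith
  have hBT := batches_le hT
  have hn : I.horizon + I.batches ≤ (6 * I.T : ℕ) := by
    have h2 : Real.log I.T ≤ I.T - 1 := Real.log_le_sub_one_of_pos (by linarith)
    push_cast
    linarith
  have hB : (I.batches : ℝ) ≤ 4 * Λ := by linarith
  set γ := g * I.C * ℓ with hγdef
  have hγ : 0 ≤ γ := by positivity
  have hsqrtγ : √(γ * K) ≤ √g * Λ * √(I.C * K) := by
    have h1 : √ℓ ≤ Λ := by
      rw [Real.sqrt_le_left (by linarith)]
      nlinarith
    rw [hγdef, show g * I.C * ℓ * K = g * ℓ * (I.C * K) by ring, Real.sqrt_mul (by positivity),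
      Real.sqrt_mul (by linarith)]
    gcongr
  have hroot : √(I.C * K) * √(I.α * (2 * I.C + 2) * I.T) ≤ 2 * I.C * Q := by
    rw [← Real.sqrt_mul (by positivity)]
    refine Real.sqrt_le_iff.2 ⟨by positivity, ?_⟩
    rw [mul_pow, hQ, Real.sq_sqrt (by positivity)]
    have h1 : (I.C : ℝ) * (2 * I.C + 2) ≤ (2 * I.C) ^ 2 := by nlinarith
    calc (I.C : ℝ) * K * (I.α * (2 * I.C + 2) * I.T)
        = (I.C * (2 * I.C + 2)) * (I.α * K * I.T) := by ring
      _ ≤ (2 * I.C) ^ 2 * (I.α * K * I.T) := mul_le_mul_of_nonneg_right h1 (by positivity)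
  have hCK : 1 ≤ √((I.C : ℝ) * K) :=
    Real.one_le_sqrt.2 (one_le_mul_of_one_le_of_one_le hCR hKR)
  have hmain : 2 * (1 + 2 * √(γ * K)) * √(I.α * (2 * I.C + 2) * I.T) +
      (2 * I.C + 2) * (c * N * K) ≤ 8 * (1 + 2 * √g) * Λ * (I.C * Q) := by
    have h1 : 1 + 2 * √(γ * K) ≤ (1 + 2 * √g) * Λ * √(I.C * K) := by
      have : 1 ≤ Λ * √(I.C * K) := one_le_mul_of_one_le_of_one_le hΛ1 hCK
      nlinarith
    have h2 : 2 * (1 + 2 * √(γ * K)) * √(I.α * (2 * I.C + 2) * I.T) ≤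
        4 * (1 + 2 * √g) * Λ * (I.C * Q) := by
      calc 2 * (1 + 2 * √(γ * K)) * √(I.α * (2 * I.C + 2) * I.T)
          ≤ 2 * ((1 + 2 * √g) * Λ * √(I.C * K)) * √(I.α * (2 * I.C + 2) * I.T) := by gcongr
        _ = 2 * ((1 + 2 * √g) * Λ) * (√(I.C * K) * √(I.α * (2 * I.C + 2) * I.T)) := by ring
        _ ≤ 2 * ((1 + 2 * √g) * Λ) * (2 * I.C * Q) := by gcongr
        _ = _ := by ring
    have h3 : (2 * I.C + 2) * (c * N * K) ≤ 4 * (1 + 2 * √g) * Λ * (I.C * Q) := by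
      calc (2 * I.C + 2) * (c * N * K) ≤ (4 * I.C) * Q :=
            mul_le_mul (by linarith) hcNK (by positivity) (by positivity)
        _ = 4 * 1 * (I.C * Q) := by ring
        _ ≤ 4 * ((1 + 2 * √g) * Λ) * (I.C * Q) := by
            gcongr
            exact one_le_mul_of_one_le_of_one_le (by linarith) hΛ1
        _ = _ := by ring
    linarith
  have hR : N * (I.batches * (2 * (1 + 2 * √(γ * K)) * √(I.α * (2 * I.C + 2) * I.T) +
      (2 * I.C + 2) * (c * N * K))) ≤ 32 * (1 + 2 * √g) * Λ ^ 2 * (N * I.C * Q) := by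
    calc _ ≤ N * ((4 * Λ) * (8 * (1 + 2 * √g) * Λ * (I.C * Q))) := by gcongr
      _ = _ := by ring
  have hfinal := regret_le_of_pseudoRegret_le (I := I) hν γ
    (R := 32 * (1 + 2 * √g) * Λ ^ 2 * (N * I.C * Q)) (by positivity)
    (I.measurableSet_badEvent γ (meanReward ν) (6 * I.T)) fun x hx =>
      (pseudoRegret_le_of_notMem_badEvent hK hα hH hHT hlogb hc hdec hU hμ hν.mean_mem hγ hx
        hn).trans hR
  have hbad := measure_badEvent_mul_le hν hN hK hC hT hg
  have h72 : 72 ≤ 72 * Λ ^ 2 * (N * I.C * Q) := by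
    have := one_le_mul_of_one_le_of_one_le hΛ2 hNCQ
    linarith
  linarith

end Law

end Input

end AnonBandit

open AnonBandit in
theorem theorem1 :
    (∃ g₀ : ℝ, 0 < g₀ ∧ ∀ g : ℝ, g₀ ≤ g → ∃ A : ℝ, 0 < A ∧ ∃ p : ℕ,
      ∀ (N K : ℕ), 1 ≤ N → 1 ≤ K →
      ∀ (I : Input N K), 1 ≤ I.C → 1 ≤ I.T → 1 ≤ I.α →
      ∀ c : ℝ, 0 ≤ c → IsDecomposer I.C I.U I.α c I.decompose →
        c * N * K ≤ √(I.α * K * I.T) →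
        (I.strategy (g * I.C * Real.log (N * K * I.T))).IsAnonymous I.C ∧
        ∀ (ν : Fin N → Fin K → MeasureTheory.Measure ℝ)
          [∀ i j, MeasureTheory.IsProbabilityMeasure (ν i j)],
          IsInstance ν → UserCluster I.U (meanReward ν) →
          MeasureTheory.Integrable
            (totalReward (I.strategy (g * I.C * Real.log (N * K * I.T))) I.T) (rewardLaw ν) ∧
          regret ν (I.strategy (g * I.C * Real.log (N * K * I.T))) I.T ≤
            A * (1 + Real.log (N * K * I.C * I.T)) ^ p *
              (N * I.C * √(I.α * K * I.T))) ∧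
    (∀ N K C U : ℕ, 1 ≤ N → 1 ≤ K → 1 ≤ C → C + 1 ≤ U →
      ∃ dec : ℝ → (Fin N → Finset (Fin K)) → AssignmentSeq N K,
        IsDecomposer C U (max 1 (⌈(K * (C + 1) : ℝ) / U⌉₊ : ℝ)) 2 dec) := by
  refine ⟨⟨120, by norm_num, fun g hg => ⟨32 * (1 + 2 * √g) + 72, by positivity, 2, ?_⟩⟩, ?_⟩
  · intro N K hN hK I hC hT hα c hc hdec hcNK
    refine ⟨I.isAnonymous_strategy _, fun ν _ hν hU => ⟨?_, ?_⟩⟩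
    · exact integrable_totalReward hν (I.measurable_arm _) I.T
    · exact Input.regret_le hν hN hK hC hT hα hc hdec hcNK hU hg
  · intro N K C U hN hK _ hU
    exact exists_isDecomposer hN hK hU
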